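/- Let $\Bbbk$ be a commutative ring (for instance a field, or $\mathbb{Z}$), let $n\ge 0$ and $a\in\Bbbk$. Let $\mathrm{Pol}_n=\Bbbk[x_1,\dots,x_n]$ and let $R_n=\mathrm{Pol}_n\otimes_{\Bbbk}\bigwedge(\omega_1,\dots,\omega_n)$, with the action of the symmetric group $\mathfrak S_n$ by algebra automorphisms in which the simple transposition $s_j$ exchanges $x_j$ and $x_{j+1}$ and $s_j(\omega_k)=\omega_k+\delta_{j,k}(x_k-x_{k+1})\omega_{k+1}$. Let $A_n=\mathrm{End}_{R_n^{\mathfrak S_n}}(R_n)$ be the enhanced nilHecke algebra, the algebra of endomorphisms of $R_n$ as a right $R_n^{\mathfrak S_n}$-module. It contains the operators $x_i$ and $\omega_i$ of left multiplication $(1\le i\le n)$ and the divided difference operators $T_i(f)=\frac{f-s_i(f)}{x_i-x_{i+1}}$ $(1\le i\le n-1)$. For $1\le i<j\le n$ put $$\alpha_{i,j}=\sum_{l=j}^{n}x_l^2\prod_{m=i+1}^{j-1}(x_m-x_l).$$ Then there is a unique $\Bbbk$-linear derivation $\mathrm d_a\colon A_n\to A_n$ such that $$\mathrm d_a(x_i)=x_i^2,\qquad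 \mathrm d_a(\omega_i)=\sum_{j=i+1}^{n}\alpha_{i,j}\,\omega_j,\qquad \mathrm d_a(T_i)=a-(a+1)x_iT_i+(a-1)x_{i+1}T_i .$$ In particular $\mathrm d_a(\omega_n)=0$ if $n\ge1$. Moreover $\mathrm d_a$ restricts to the Khovanov–Qi derivation on the nilHecke algebra $\mathrm{nh}_n=\mathrm{End}_{\mathrm{Pol}_n^{\mathfrak S_n}}(\mathrm{Pol}_n)$. That is, there is an injective algebra homomorphism $\iota\colon\mathrm{nh}_n\to A_n$ with $\iota(\xi)|_{\mathrm{Pol}_n}=\xi$ for all $\xi$, and for all $\alpha_1,\dots,\alpha_n\in\Bbbk$ with $\alpha_{i+1}-\alpha_i=a$ for $1\le i\le n-1$ one has $\mathrm d_a(\iota(\xi))=\iota(D_\alpha\circ\xi-\xi\circ D_\alpha)$ for all $\xi\in\mathrm{nh}_n$, where $D_\alpha(f)=\sum_i x_i^2\,\partial f/\partial x_i+\bigl(\sum_i\alpha_ix_i\bigr)f$ on $\mathrm{Pol}_n$. If $\Bbbk$ has prime characteristic $p$ and $a$ lies in the image of $\mathbb F_p$ in $\Bbbk$, then $(A_n,\mathrm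 d_a)$ is a $p$-dg algebra. That is, $A_n$ is a $\mathbb Z$-graded algebra for the $q$-grading, in which an endomorphism has degree $s$ if it raises the $q$-degree of $R_n$ by $s$, where $\deg_q x_i=2$ and $\deg_q\omega_i=-2i$; and $\mathrm d_a$ is a derivation, homogeneous of degree $2$, with $\mathrm d_a^{\,p}=0$. -/

import Mathlib

open scoped TensorProduct
open MvPolynomial

noncomputable section

namespace EnhancedNilHecke

/- Throughout, the variables `x_1, …, x_n` and `ω_1, …, ω_n` are indexed by `i : Fin n`, so that
`i : Fin n` stands for the number `i + 1` of the usual 1-based notation. The simple transpositions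
`s_1, …, s_{n-1}` and the operators `T_1, …, T_{n-1}` are indexed by `j : Fin (n - 1)`; the
transposition with index `j` exchanges the positions `lo j` and `hi j = lo j + 1`. -/

/-- The smaller of the two positions exchanged by the simple transposition with index `j`. -/
def lo {n : ℕ} (j : Fin (n - 1)) : Fin n := ⟨j, by omega⟩

/-- The larger of the two positions exchanged by the simple transposition with index `j`. -/
def hi {n : ℕ} (j : Fin (n - 1)) : Fin n := ⟨j + 1, by omega⟩

theorem lo_ne_hi {n : ℕ} (j : Fin (n - 1)) : lo j ≠ hi j := by
  intro h
  have := congrArg Fin.val h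
  simp [lo, hi] at this

/-- The polynomial ring `Pol_n = k[x_1, …, x_n]`. -/
abbrev Pol (k : Type*) [CommRing k] (n : ℕ) : Type _ := MvPolynomial (Fin n) k

/-- The ring of extended polynomials `R_n = Pol_n ⊗ Λ(ω_1, …, ω_n)`. -/
def ExtPol (k : Type*) [CommRing k] (n : ℕ) : Type _ :=
  Pol k n ⊗[k] ExteriorAlgebra k (Fin n → k)

instance (k : Type*) [CommRing k] (n : ℕ) : Ring (ExtPol k n) :=
  inferInstanceAs (Ring (Pol k n ⊗[k] ExteriorAlgebra k (Fin n → k)))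

instance (k : Type*) [CommRing k] (n : ℕ) : Algebra k (ExtPol k n) :=
  inferInstanceAs (Algebra k (Pol k n ⊗[k] ExteriorAlgebra k (Fin n → k)))

section

variable (k : Type*) [CommRing k] (n : ℕ)

/-- The inclusion `Pol_n ⊆ R_n`. -/
def ofPol : Pol k n →ₐ[k] ExtPol k n :=
  (Algebra.TensorProduct.includeLeft :
    Pol k n →ₐ[k] Pol k n ⊗[k] ExteriorAlgebra k (Fin n → k))

/-- The inclusion `Λ(ω_1, …, ω_n) ⊆ R_n`. -/
def ofExt : ExteriorAlgebra k (Fin n → k) →ₐ[k] ExtPol k n :=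
  (Algebra.TensorProduct.includeRight :
    ExteriorAlgebra k (Fin n → k) →ₐ[k] Pol k n ⊗[k] ExteriorAlgebra k (Fin n → k))

variable {n}

/-- The even generator `x_i` of `R_n`. -/
def xv (i : Fin n) : ExtPol k n := ofPol k n (X i)

/-- The odd generator `ω_i` of `R_n`. -/
def omv (i : Fin n) : ExtPol k n := ofExt k n (ExteriorAlgebra.ι k (Pi.single i 1))

variable (n)

theorem ofPol_mul_ofExt (a : Pol k n) (b : ExteriorAlgebra k (Fin n → k)) :
    ofPol k n a * ofExt k n b =
      (a ⊗ₜ[k] b : Pol k n ⊗[k] ExteriorAlgebra k (Fin n → k)) := by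
  change (a ⊗ₜ[k] (1 : ExteriorAlgebra k (Fin n → k))) * ((1 : Pol k n) ⊗ₜ[k] b) = _
  rw [Algebra.TensorProduct.tmul_mul_tmul, mul_one, one_mul]

theorem extPol_induction {P : ExtPol k n → Prop} (f : ExtPol k n)
    (zero : P 0) (mul : ∀ a b, P (ofPol k n a * ofExt k n b))
    (add : ∀ f g, P f → P g → P (f + g)) : P f :=
  TensorProduct.induction_on (motive := P) f zero
    (fun a b => by have := mul a b; rwa [ofPol_mul_ofExt] at this) add

theorem ofPol_comm (f : Pol k n) (g : ExtPol k n) : Commute (ofPol k n f) g := by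
  induction g using extPol_induction with
  | zero => exact Commute.zero_right _
  | mul a b =>
    refine Commute.mul_right ?_ ?_
    · rw [Commute, SemiconjBy, ← map_mul, ← map_mul, mul_comm]
    · refine (ofPol_mul_ofExt k n f b).trans ?_
      change _ = ((1 : Pol k n) ⊗ₜ[k] b) * (f ⊗ₜ[k] (1 : ExteriorAlgebra k (Fin n → k)))
      rw [Algebra.TensorProduct.tmul_mul_tmul, mul_one, one_mul]
  | add a b ha hb => exact ha.add_right hb

variable {n}

/-- The linear map `m ↦ s_j(m)` on the span of the `ω`'s, i.e. `ω_k ↦ ω_k` for `k ≠ j` and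
`ω_j ↦ ω_j + (x_j - x_{j+1}) ω_{j+1}`. -/
def simpleReflOm (j : Fin (n - 1)) : (Fin n → k) →ₗ[k] ExtPol k n :=
  (ofExt k n).toLinearMap ∘ₗ ExteriorAlgebra.ι k +
    (LinearMap.proj (lo j)).smulRight ((xv k (lo j) - xv k (hi j)) * omv k (hi j))

theorem simpleReflOm_single (j : Fin (n - 1)) (i : Fin n) :
    simpleReflOm k j (Pi.single i 1) =
      omv k i + if i = lo j then (xv k (lo j) - xv k (hi j)) * omv k (hi j) else 0 := by
  by_cases h : i = lo j
  · subst h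
    simp [simpleReflOm, omv]
  · simp [simpleReflOm, omv, h]

theorem simpleReflOm_sq (j : Fin (n - 1)) (m : Fin n → k) :
    simpleReflOm k j m * simpleReflOm k j m = 0 := by
  have hp : xv k (lo j) - xv k (hi j) = ofPol k n (X (lo j) - X (hi j)) := by simp [xv]
  simp only [simpleReflOm, LinearMap.add_apply, LinearMap.comp_apply, AlgHom.toLinearMap_apply,
    LinearMap.smulRight_apply, LinearMap.proj_apply, omv, hp]
  set c := m (lo j)
  set v : Fin n → k := Pi.single (hi j) 1
  set q := ofPol k n (X (lo j) - X (hi j)) with hq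
  have hc : ∀ g, q * g = g * q := fun g => ofPol_comm k n _ g
  have e1 : ∀ w : Fin n → k, ofExt k n (ExteriorAlgebra.ι k w) * ofExt k n (ExteriorAlgebra.ι k w)
      = 0 := fun w => by rw [← map_mul, ExteriorAlgebra.ι_sq_zero, map_zero]
  have e2 : ofExt k n (ExteriorAlgebra.ι k m) * ofExt k n (ExteriorAlgebra.ι k v) +
      ofExt k n (ExteriorAlgebra.ι k v) * ofExt k n (ExteriorAlgebra.ι k m) = 0 := by
    rw [← map_mul (ofExt k n), ← map_mul (ofExt k n), ← map_add (ofExt k n),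
      ExteriorAlgebra.ι_add_mul_swap, map_zero]
  set a := ofExt k n (ExteriorAlgebra.ι k m)
  set b := ofExt k n (ExteriorAlgebra.ι k v)
  have hqab : a * (q * b) = q * (a * b) := by rw [← mul_assoc, ← hc, mul_assoc]
  have hqbb : q * b * (q * b) = 0 := by
    rw [mul_assoc, ← mul_assoc b, ← hc b, mul_assoc q b b, e1, mul_zero, mul_zero]
  have : (a + c • (q * b)) * (a + c • (q * b))
      = a * a + c • (q * (a * b + b * a)) + (c * c) • (q * b * (q * b)) := by
    simp only [add_mul, mul_add, smul_mul_assoc, mul_smul_comm, smul_smul, hqab, mul_assoc q b a,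
      smul_add]
    abel
  rw [this, e1, e2, hqbb]
  simp

/-- The action of the simple transposition `s_j` on `R_n` by algebra automorphisms: it exchanges
`x_j` and `x_{j+1}`, and `s_j(ω_k) = ω_k + δ_{j,k} (x_k - x_{k+1}) ω_{k+1}`
(see `simpleRefl_x`, `simpleRefl_om`). -/
def simpleRefl (j : Fin (n - 1)) : ExtPol k n →ₐ[k] ExtPol k n :=
  (Algebra.TensorProduct.lift
    ((ofPol k n).comp (rename (Equiv.swap (lo j) (hi j))))
    (ExteriorAlgebra.lift k ⟨simpleReflOm k j, simpleReflOm_sq k j⟩)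
    (fun _ _ => ofPol_comm k n _ _) :
      Pol k n ⊗[k] ExteriorAlgebra k (Fin n → k) →ₐ[k] ExtPol k n)

theorem simpleRefl_ofPol_mul_ofExt (j : Fin (n - 1)) (f : Pol k n)
    (g : ExteriorAlgebra k (Fin n → k)) :
    simpleRefl k j (ofPol k n f * ofExt k n g) =
      ofPol k n (rename (Equiv.swap (lo j) (hi j)) f) *
        ExteriorAlgebra.lift k ⟨simpleReflOm k j, simpleReflOm_sq k j⟩ g := by
  rw [ofPol_mul_ofExt]
  have h := Algebra.TensorProduct.lift_tmul
    ((ofPol k n).comp (rename (Equiv.swap (lo j) (hi j))))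
    (ExteriorAlgebra.lift k ⟨simpleReflOm k j, simpleReflOm_sq k j⟩)
    (fun _ _ => ofPol_comm k n _ _) f g
  exact h

theorem simpleRefl_ofPol (j : Fin (n - 1)) (f : Pol k n) :
    simpleRefl k j (ofPol k n f) = ofPol k n (rename (Equiv.swap (lo j) (hi j)) f) := by
  simpa using simpleRefl_ofPol_mul_ofExt k j f 1

theorem simpleRefl_ofExt_ι (j : Fin (n - 1)) (m : Fin n → k) :
    simpleRefl k j (ofExt k n (ExteriorAlgebra.ι k m)) = simpleReflOm k j m := by
  simpa using simpleRefl_ofPol_mul_ofExt k j 1 (ExteriorAlgebra.ι k m)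

theorem simpleRefl_x (j : Fin (n - 1)) (i : Fin n) :
    simpleRefl k j (xv k i) = xv k (Equiv.swap (lo j) (hi j) i) := by
  simp [xv, simpleRefl_ofPol]

theorem simpleRefl_om (j : Fin (n - 1)) (i : Fin n) :
    simpleRefl k j (omv k i) =
      omv k i + if i = lo j then (xv k (lo j) - xv k (hi j)) * omv k (hi j) else 0 := by
  rw [← simpleReflOm_single, omv, simpleRefl_ofExt_ι]

variable (n) in
/-- The subalgebra `R_n^{S_n}` of invariants of `R_n`: as the simple transpositions generate the
symmetric group, these are the elements fixed by all of them. -/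
def invariants : Subalgebra k (ExtPol k n) :=
  ⨅ j : Fin (n - 1), AlgHom.equalizer (simpleRefl k j) (AlgHom.id k (ExtPol k n))

theorem mem_invariants (r : ExtPol k n) :
    r ∈ invariants k n ↔ ∀ j : Fin (n - 1), simpleRefl k j r = r := by
  simp [invariants, Algebra.mem_iInf]

variable (n) in
/-- The enhanced nilHecke algebra `A_n`, the algebra of endomorphisms of `R_n` as a right module
over `R_n^{S_n}`, the product being composition. (`R_n` is supercommutative, so this is the same as
the algebra spanned by the even and odd endomorphisms of the left supermodule `R_n`, with the usual
signs.) -/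
abbrev EnhNilHecke : Type _ := Module.End (invariants k n).op (ExtPol k n)

variable (n) in
/-- An element of `R_n`, viewed as the element of `A_n` that multiplies by it from the left. -/
def mulL : ExtPol k n →ₐ[k] EnhNilHecke k n where
  toFun r :=
    { toFun := fun f => r * f
      map_add' := mul_add r
      map_smul' := fun c f => by
        change r * (f * MulOpposite.unop (c : (ExtPol k n)ᵐᵒᵖ)) = r * f * MulOpposite.unop c.1
        rw [mul_assoc] }
  map_one' := by ext f; simp
  map_mul' r r' := by ext f; simp [mul_assoc]
  map_zero' := by ext f; simp
  map_add' r r' := by ext f; simp [add_mul]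
  commutes' c := by
    ext f
    simp [Algebra.algebraMap_eq_smul_one]

/-- `x_i` as an element of `A_n`. -/
def Xop (i : Fin n) : EnhNilHecke k n := mulL k n (xv k i)

/-- `ω_i` as an element of `A_n`. -/
def Omop (i : Fin n) : EnhNilHecke k n := mulL k n (omv k i)

/-! ### Divided differences -/

theorem pol_regular {i j : Fin n} (h : i ≠ j) (f : Pol k n)
    (hf : (X i - X j : Pol k n) * f = 0) : f = 0 := by
  let φ : Pol k n →ₐ[k] Pol k n := aeval (fun l => if l = i then X i + X j else X l)
  let ψ : Pol k n →ₐ[k] Pol k n := aeval (fun l => if l = i then X i - X j else X l)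
  have h1 : X i * φ f = 0 := by
    have := congrArg φ hf
    simpa [φ, h.symm] using this
  have h2 : φ f = 0 := by
    have hX : IsRegular (X i : Pol k n) := isRegular_X
    exact hX.left (h1.trans (mul_zero _).symm)
  have h3 : ψ.comp φ = AlgHom.id k _ := by
    ext l : 1
    by_cases hl : l = i
    · subst hl; simp [φ, ψ, h.symm]
    · simp [φ, ψ, hl]
  have := DFunLike.congr_fun h3 f
  simpa [h2] using this.symm

theorem ext_regular (j : Fin (n - 1)) (f : ExtPol k n)
    (hf : (xv k (lo j) - xv k (hi j)) * f = 0) : f = 0 := by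
  have : Module.Free k (ExteriorAlgebra k (Fin n → k)) :=
    Module.Free.of_basis (Pi.basisFun k (Fin n)).ExteriorAlgebra
  let u : Pol k n →ₗ[k] Pol k n := LinearMap.mulLeft k (X (lo j) - X (hi j))
  have hu : Function.Injective u := by
    rw [injective_iff_map_eq_zero]
    exact fun g hg => pol_regular k (lo_ne_hi j) g hg
  have hU := Module.Flat.rTensor_preserves_injective_linearMap
    (M := ExteriorAlgebra k (Fin n → k)) u hu
  have key : ∀ g : ExtPol k n, (LinearMap.rTensor (ExteriorAlgebra k (Fin n → k)) u g : ExtPol k n)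
      = (xv k (lo j) - xv k (hi j)) * g := by
    intro g
    induction g using extPol_induction with
    | zero => rw [mul_zero]; exact map_zero (LinearMap.rTensor (ExteriorAlgebra k (Fin n → k)) u)
    | mul a b =>
      have hp : xv k (lo j) - xv k (hi j) = ofPol k n (X (lo j) - X (hi j)) := by simp [xv]
      rw [← mul_assoc, hp, ← map_mul, ofPol_mul_ofExt, ofPol_mul_ofExt]
      exact LinearMap.rTensor_tmul _ u b a
    | add a b ha hb =>
      rw [mul_add, ← ha, ← hb]
      exact map_add (LinearMap.rTensor (ExteriorAlgebra k (Fin n → k)) u) a b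
  refine hU (((key f).trans hf).trans ?_)
  exact (map_zero (LinearMap.rTensor (ExteriorAlgebra k (Fin n → k)) u)).symm

theorem exists_divDiff (j : Fin (n - 1)) (f : ExtPol k n) :
    ∃ g, (xv k (lo j) - xv k (hi j)) * g = f - simpleRefl k j f := by
  have hp : xv k (lo j) - xv k (hi j) = ofPol k n (X (lo j) - X (hi j)) := by simp [xv]
  have hc : ∀ g, (xv k (lo j) - xv k (hi j)) * g = g * (xv k (lo j) - xv k (hi j)) := fun g => by
    rw [hp]; exact ofPol_comm k n _ g
  set δ := xv k (lo j) - xv k (hi j) with hδ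
  have hadd : ∀ f f' : ExtPol k n, (∃ g, δ * g = f - simpleRefl k j f) →
      (∃ g, δ * g = f' - simpleRefl k j f') →
      ∃ g, δ * g = (f + f') - simpleRefl k j (f + f') := by
    rintro f f' ⟨g, hg⟩ ⟨g', hg'⟩
    refine ⟨g + g', ?_⟩
    rw [mul_add, hg, hg', map_add]
    abel
  have hmul : ∀ f f' : ExtPol k n, (∃ g, δ * g = f - simpleRefl k j f) →
      (∃ g, δ * g = f' - simpleRefl k j f') →
      ∃ g, δ * g = (f * f') - simpleRefl k j (f * f') := by
    rintro f f' ⟨g, hg⟩ ⟨g', hg'⟩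
    refine ⟨g * f' + simpleRefl k j f * g', ?_⟩
    rw [mul_add, ← mul_assoc, hg, ← mul_assoc, hc, mul_assoc, hg', map_mul]
    simp only [sub_mul, mul_sub]
    abel
  have hconst : ∀ c : k, ∃ g, δ * g = algebraMap k (ExtPol k n) c -
      simpleRefl k j (algebraMap k (ExtPol k n) c) := fun c => ⟨0, by
    rw [AlgHom.commutes, sub_self, mul_zero]⟩
  have hpol : ∀ q : Pol k n, ∃ g, δ * g = ofPol k n q - simpleRefl k j (ofPol k n q) := by
    intro q
    induction q using MvPolynomial.induction_on with
    | C c =>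
      have := hconst c
      rwa [← (ofPol k n).commutes c] at this
    | add p q hp hq => rw [map_add]; exact hadd _ _ hp hq
    | mul_X p i hp =>
      rw [map_mul]
      refine hmul _ _ hp ?_
      change ∃ g, δ * g = xv k i - simpleRefl k j (xv k i)
      rw [simpleRefl_x]
      by_cases h1 : i = lo j
      · subst h1; exact ⟨1, by simp [hδ]⟩
      by_cases h2 : i = hi j
      · subst h2; exact ⟨-1, by rw [mul_neg, mul_one, hδ]; simp⟩
      · exact ⟨0, by rw [Equiv.swap_apply_of_ne_of_ne h1 h2]; simp⟩
  have hext : ∀ q, ∃ g, δ * g = ofExt k n q - simpleRefl k j (ofExt k n q) := by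
    intro q
    induction q using ExteriorAlgebra.induction with
    | algebraMap c =>
      have := hconst c
      rwa [← (ofExt k n).commutes c] at this
    | add p q hp hq => rw [map_add]; exact hadd _ _ hp hq
    | mul p q hp hq => rw [map_mul]; exact hmul _ _ hp hq
    | ι m =>
      rw [simpleRefl_ofExt_ι]
      refine ⟨-(m (lo j) • omv k (hi j)), ?_⟩
      rw [mul_neg, mul_smul_comm]
      simp [simpleReflOm, hδ]
  induction f using extPol_induction with
  | zero => exact ⟨0, by simp⟩
  | mul a b => exact hmul _ _ (hpol a) (hext b)
  | add a b ha hb => exact hadd _ _ ha hb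

theorem divDiff_unique (j : Fin (n - 1)) {g g' : ExtPol k n}
    (h : (xv k (lo j) - xv k (hi j)) * g = (xv k (lo j) - xv k (hi j)) * g') : g = g' :=
  sub_eq_zero.1 (ext_regular k j _ (by rw [mul_sub, h, sub_self]))

/-- The divided difference `T_j(f) = (f - s_j(f)) / (x_j - x_{j+1})`, for `f` in `R_n`. -/
def divDiff (j : Fin (n - 1)) (f : ExtPol k n) : ExtPol k n := (exists_divDiff k j f).choose

theorem divDiff_spec (j : Fin (n - 1)) (f : ExtPol k n) :
    (xv k (lo j) - xv k (hi j)) * divDiff k j f = f - simpleRefl k j f :=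
  (exists_divDiff k j f).choose_spec

/-- `T_j` as an element of `A_n`. -/
def Tdiv (j : Fin (n - 1)) : EnhNilHecke k n where
  toFun := divDiff k j
  map_add' f g := divDiff_unique k j (by
    rw [mul_add, divDiff_spec, divDiff_spec, divDiff_spec, map_add]; abel)
  map_smul' c f := divDiff_unique k j (by
    have hr := (mem_invariants k (MulOpposite.unop (c : (ExtPol k n)ᵐᵒᵖ))).1 c.2 j
    change _ = (xv k (lo j) - xv k (hi j)) *
      (divDiff k j f * MulOpposite.unop (c : (ExtPol k n)ᵐᵒᵖ))
    rw [← mul_assoc, divDiff_spec, divDiff_spec, sub_mul]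
    change f * MulOpposite.unop (c : (ExtPol k n)ᵐᵒᵖ) - simpleRefl k j (f * MulOpposite.unop _) = _
    rw [map_mul, hr])

/-! ### The Khovanov–Qi derivation on the nilHecke algebra -/

variable (n) in
/-- The nilHecke algebra `nh_n = End_{Sym_n}(Pol_n)`. -/
abbrev NilHecke : Type _ := Module.End (symmetricSubalgebra (Fin n) k) (Pol k n)

variable (n) in
/-- The derivation of `Pol_n` with `x_i ↦ x_i ^ 2`. -/
def polD : Derivation k (Pol k n) (Pol k n) := mkDerivation k (fun i => X i ^ 2)

theorem polD_symmetric (s : Pol k n) (hs : s ∈ symmetricSubalgebra (Fin n) k) :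
    polD k n s ∈ symmetricSubalgebra (Fin n) k := by
  have key : ∀ (e : Equiv.Perm (Fin n)) (f : Pol k n),
      polD k n (rename e f) = rename e (polD k n f) := by
    intro e f
    induction f using MvPolynomial.induction_on with
    | C c => simp [polD]
    | add p q hp hq => simp [hp, hq]
    | mul_X p i hp =>
      simp only [map_mul, Derivation.leibniz, hp, rename_X, smul_eq_mul, map_add]
      simp [polD]
  rw [mem_symmetricSubalgebra] at hs ⊢
  intro e
  rw [← key, hs e]

/-- The action of the derivation on `𝒫_n = Pol_n · v`, where `v ↦ (∑ α_i x_i) v`, written on the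
coefficient of `v`. -/
def twistedD (α : Fin n → k) : Pol k n →ₗ[k] Pol k n :=
  (polD k n).toLinearMap + LinearMap.mulLeft k (∑ i, C (α i) * X i)

/-- The derivation `ξ ↦ (f ↦ D_α(ξ(f)) - ξ(D_α(f)))` of the nilHecke algebra, `D_α` being the
derivation on `Pol_n · v` with `v ↦ (∑ α_i x_i) v`. If `α_{i+1} - α_i = a` for all `i` this is the
Khovanov–Qi derivation with parameter `a`. -/
def khovanovQi (α : Fin n → k) : NilHecke k n →ₗ[k] NilHecke k n where
  toFun ξ :=
    { toFun := fun f => twistedD k α (ξ f) - ξ (twistedD k α f)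
      map_add' := fun f g => by simp only [map_add]; abel
      map_smul' := fun s f => by
        have h : ∀ g, twistedD k α (s • g) =
            (⟨polD k n s, polD_symmetric k _ s.2⟩ : symmetricSubalgebra (Fin n) k) • g +
              s • twistedD k α g := by
          intro g
          simp only [twistedD, LinearMap.add_apply, Subalgebra.smul_def, smul_eq_mul,
            Derivation.coeFn_coe, Derivation.leibniz,
            LinearMap.mulLeft_apply]
          ring
        rw [map_smul, h, h, map_add, map_smul, map_smul, RingHom.id_apply, smul_sub]
        abel }
  map_add' ξ η := by
    ext f : 1
    change twistedD k α (ξ f + η f) - (ξ (twistedD k α f) + η (twistedD k α f)) =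
      (twistedD k α (ξ f) - ξ (twistedD k α f)) + (twistedD k α (η f) - η (twistedD k α f))
    rw [map_add]
    abel
  map_smul' c ξ := by
    ext f : 1
    change twistedD k α (c • ξ f) - c • ξ (twistedD k α f) =
      c • (twistedD k α (ξ f) - ξ (twistedD k α f))
    rw [map_smul, smul_sub]

/-! ### The derivation on `A_n` -/

/-- The polynomials `α_{i,j} = ∑_{l = j}^{n} x_l ^ 2 ∏_{m = i+1}^{j-1} (x_m - x_l)`. -/
def alpha (i j : Fin n) : Pol k n :=
  ∑ l ∈ Finset.Ici j, X l ^ 2 * ∏ m ∈ Finset.Ioo i j, (X m - X l)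

/-- `d` is a derivation of `A_n` with the prescribed values on the generators. -/
structure IsEnhancedDerivation (a : k) (d : EnhNilHecke k n →ₗ[k] EnhNilHecke k n) : Prop where
  leibniz : ∀ ξ η, d (ξ * η) = d ξ * η + ξ * d η
  map_X : ∀ i, d (Xop k i) = Xop k i ^ 2
  map_Om : ∀ i, d (Omop k i) = ∑ j ∈ Finset.Ioi i, mulL k n (ofPol k n (alpha k i j)) * Omop k j
  map_T : ∀ j, d (Tdiv k j) =
    a • (1 : EnhNilHecke k n) - (a + 1) • (Xop k (lo j) * Tdiv k j)
      + (a - 1) • (Xop k (hi j) * Tdiv k j)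

/-! ### Gradings and `p`-dg algebras -/

variable (n) in
/-- The homogeneous part of `R_n` of `q`-degree `t`, where `x_i` has `q`-degree `2` and `ω_i` (in
1-based numbering) has `q`-degree `-2 i`: it is spanned by the products of generators that have
total degree `t`. -/
def extPolDeg (t : ℤ) : Submodule k (ExtPol k n) :=
  Submodule.span k {r | ∃ (m : Fin n →₀ ℕ) (l : List (Fin n)),
    2 * (∑ i, (m i : ℤ)) - (l.map fun i => 2 * ((i : ℤ) + 1)).sum = t ∧
      r = ofPol k n (monomial m 1) * (l.map (omv k)).prod}

variable (n) in
/-- The homogeneous part of `A_n` of `q`-degree `s`: the endomorphisms that raise the `q`-degree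
by `s`. -/
def enhDeg (s : ℤ) : Submodule k (EnhNilHecke k n) where
  carrier := {ξ | ∀ t, ∀ f ∈ extPolDeg k n t, ξ f ∈ extPolDeg k n (t + s)}
  add_mem' hξ hη t f hf := Submodule.add_mem _ (hξ t f hf) (hη t f hf)
  zero_mem' _ _ _ := Submodule.zero_mem _
  smul_mem' c _ hξ t f hf := Submodule.smul_mem _ c (hξ t f hf)

end

/-- `(A, d)` is a `p`-dg algebra over `k` with respect to the `ℤ`-grading `𝒜` of `A`. -/
structure IsPDGAlgebra {k A : Type*} [CommRing k] [Ring A] [Algebra k A] (p : ℕ)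
    (𝒜 : ℤ → Submodule k A) (d : A →ₗ[k] A) : Prop where
  gradedMonoid : SetLike.GradedMonoid 𝒜
  isInternal : DirectSum.IsInternal 𝒜
  leibniz : ∀ a b, d (a * b) = d a * b + a * d b
  degree_two : ∀ i, ∀ a ∈ 𝒜 i, d a ∈ 𝒜 (i + 2)
  nilpotent : ∀ a, d^[p] a = 0

end EnhancedNilHecke

end

noncomputable section

namespace EnhancedNilHecke

variable (k : Type*) [CommRing k] {n : ℕ}

/-! ### Algebra homomorphisms out of `R_n` -/

/-! The idea is to replace the `ω_i` by generators on which the symmetric group acts trivially. Put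
`E_{i,j} = e_{j-i}(x_{i+1}, …, x_n)`, a unitriangular matrix. Its rows transform under `s_j` exactly
as the `ω_i` do, so the elements `E⁻¹ ω` are invariant, and `R_n = Pol_n ⊗ Λ(E⁻¹ ω)` with the
symmetric group acting on the first factor alone (`rename_esymmMatrix`, `extendEnd_rename`). Hence
every operator `φ` on `Pol_n` extends to `φ ⊗ 1` on `R_n`, and `extendEnd` is this algebra
homomorphism.

Existence: the derivation is the commutator with `D_α ⊗ 1`, where `α_{i+1} - α_i = a`. It preserves
`A_n` because `x_i ↦ x_i²` commutes with the symmetric group. Its value on `T_j` is a computation in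
`Pol_n` (`commD_Tdiv`). Its value on `ω_i` amounts to `D(E_{i,l}) = ∑_j α_{i,j} E_{j,l}`, which is
read off a generating function (`polDCoeffs_esymmSeries`). Since `extendEnd` is multiplicative, the
restriction to `nh_n` is the Khovanov–Qi derivation.

Uniqueness: `A_n` is generated by the `x_i`, `ω_i` and `T_j`. By the nilHecke relations alone, the
identity of `Pol_n` is a finite sum `∑ p φ` with `p` a polynomial and `φ` an operator, generated by
the `x_i` and `T_j`, whose values are symmetric (`one_mem_closure_polOps`). An endomorphism `ξ`
linear over invariants then satisfies `ξ = ∑ ξ(p) φ` (`genAlg_eq_top`). The same decomposition shows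
that `ξ ⊗ 1` is linear over invariants for `ξ` in `nh_n`.

The `p`-dg structure: the generators are homogeneous, so the homogeneous parts span `A_n`; they are
independent because a homomorphism `R_n → R_n[ℤ]` records degrees. In characteristic `p` the `p`-th
power of a commutator with `D` is the commutator with `D^p`. Moreover `D_α` is a sum of commuting
operators `x_i² ∂_i + α_i x_i`, whose `p`-th powers vanish if the `α_i` lie in the prime field. -/

variable {k} in
theorem extPol_algHom_ext {B : Type*} [Semiring B] [Algebra k B] {f g : ExtPol k n →ₐ[k] B}
    (hx : ∀ i, f (xv k i) = g (xv k i)) (hom : ∀ i, f (omv k i) = g (omv k i)) : f = g := by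
  have h1 : f.comp (ofPol k n) = g.comp (ofPol k n) := MvPolynomial.algHom_ext hx
  have h2 : f.comp (ofExt k n) = g.comp (ofExt k n) := by
    refine ExteriorAlgebra.hom_ext (LinearMap.pi_ext' fun i => LinearMap.ext_ring ?_)
    exact hom i
  ext r
  induction r using extPol_induction with
  | zero => simp
  | mul a b =>
    rw [map_mul, map_mul]
    exact congrArg₂ _ (DFunLike.congr_fun h1 a) (DFunLike.congr_fun h2 b)
  | add a b ha hb => rw [map_add, map_add, ha, hb]

theorem adjoin_xv_omv :
    Algebra.adjoin k (Set.range (xv k) ∪ Set.range (omv k)) = (⊤ : Subalgebra k (ExtPol k n)) := by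
  set S := Algebra.adjoin k (Set.range (xv k (n := n)) ∪ Set.range (omv k)) with hS
  have hP : ∀ p, ofPol k n p ∈ S := by
    intro p
    induction p using MvPolynomial.induction_on with
    | C c =>
      rw [← algebraMap_eq, AlgHom.commutes]
      exact Subalgebra.algebraMap_mem _ _
    | add p q hp hq => rw [map_add]; exact add_mem hp hq
    | mul_X p i hp =>
      rw [map_mul]
      exact mul_mem hp (Algebra.subset_adjoin (Or.inl ⟨i, rfl⟩))
  have hE : ∀ q, ofExt k n q ∈ S := by
    intro q
    induction q using ExteriorAlgebra.induction with
    | algebraMap c =>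
      rw [AlgHom.commutes]
      exact Subalgebra.algebraMap_mem _ _
    | ι m =>
      have hm : m = ∑ i, m i • (Pi.single i 1 : Fin n → k) := by
        ext l
        simp [Finset.sum_apply, Pi.single_apply]
      rw [hm, map_sum, map_sum]
      refine sum_mem fun i _ => ?_
      rw [map_smul, map_smul]
      have hi : omv k i ∈ S := Algebra.subset_adjoin (Or.inr ⟨i, rfl⟩)
      exact Subalgebra.smul_mem _ hi _
    | mul p q hp hq => rw [map_mul]; exact mul_mem hp hq
    | add p q hp hq => rw [map_add]; exact add_mem hp hq
  refine eq_top_iff.2 fun r _ => ?_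
  induction r using extPol_induction with
  | zero => exact zero_mem _
  | mul a b => exact mul_mem (hP a) (hE b)
  | add a b ha hb => exact add_mem (ha trivial) (hb trivial)

/-- The element `∑ p_j ω_j` of `R_n`. -/
def omComb : (Fin n → Pol k n) →ₗ[k] ExtPol k n :=
  ∑ j, LinearMap.mulRight k (omv k j) ∘ₗ (ofPol k n).toLinearMap ∘ₗ LinearMap.proj j

theorem omComb_apply (p : Fin n → Pol k n) :
    omComb k p = ∑ j, ofPol k n (p j) * omv k j := by
  simp [omComb, LinearMap.sum_apply]

theorem omv_mul_omv_add (i j : Fin n) : omv k i * omv k j + omv k j * omv k i = 0 := by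
  simp only [omv]
  rw [← map_mul (ofExt k n), ← map_mul (ofExt k n), ← map_add, ExteriorAlgebra.ι_add_mul_swap,
    map_zero]

theorem omv_mul_self (i : Fin n) : omv k i * omv k i = 0 := by
  simp only [omv]
  rw [← map_mul (ofExt k n), ExteriorAlgebra.ι_sq_zero, map_zero]

theorem ofPol_mul_omv_mul (p q : Pol k n) (i j : Fin n) :
    ofPol k n p * omv k i * (ofPol k n q * omv k j) =
      ofPol k n (p * q) * (omv k i * omv k j) := by
  rw [map_mul, mul_assoc, ← mul_assoc (omv k i), ← (ofPol_comm k n q (omv k i)).eq]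
  simp only [mul_assoc]

/-- The coefficients are central and the `ω_j` anticommute, so mixed terms cancel in pairs; the
diagonal terms vanish separately, which matters when 2 is not invertible. This is what lets a
substitution of the `ω_i` extend to the exterior algebra. -/
theorem omComb_mul_self (p : Fin n → Pol k n) : omComb k p * omComb k p = 0 := by
  rw [omComb_apply]
  induction (Finset.univ : Finset (Fin n)) using Finset.induction_on with
  | empty => simp
  | insert i s hi ih =>
    rw [Finset.sum_insert hi, add_mul, mul_add, mul_add, ih, ofPol_mul_omv_mul, omv_mul_self,
      mul_zero, zero_add, add_zero, Finset.mul_sum, Finset.sum_mul, ← Finset.sum_add_distrib]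
    refine Finset.sum_eq_zero fun j _ => ?_
    rw [ofPol_mul_omv_mul, ofPol_mul_omv_mul, mul_comm (p j), ← mul_add, omv_mul_omv_add, mul_zero]

/-- The linear map `m ↦ ∑_i m_i ∑_j M_{i,j} ω_j`. -/
def omSubstLin (M : Matrix (Fin n) (Fin n) (Pol k n)) : (Fin n → k) →ₗ[k] ExtPol k n :=
  omComb k ∘ₗ ∑ i, (LinearMap.proj i).smulRight (M i)

theorem omSubstLin_sq (M : Matrix (Fin n) (Fin n) (Pol k n)) (m : Fin n → k) :
    omSubstLin k M m * omSubstLin k M m = 0 :=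
  omComb_mul_self k _

/-- The `Pol_n`-linear algebra endomorphism of `R_n` with `ω_i ↦ ∑_j M_{i,j} ω_j`. -/
def omSubst (M : Matrix (Fin n) (Fin n) (Pol k n)) : ExtPol k n →ₐ[k] ExtPol k n :=
  (Algebra.TensorProduct.lift (ofPol k n)
    (ExteriorAlgebra.lift k ⟨omSubstLin k M, omSubstLin_sq k M⟩)
    (fun _ _ => ofPol_comm k n _ _) :
      Pol k n ⊗[k] ExteriorAlgebra k (Fin n → k) →ₐ[k] ExtPol k n)

theorem omSubst_ofPol_mul_ofExt (M : Matrix (Fin n) (Fin n) (Pol k n)) (f : Pol k n)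
    (g : ExteriorAlgebra k (Fin n → k)) :
    omSubst k M (ofPol k n f * ofExt k n g) =
      ofPol k n f * ExteriorAlgebra.lift k ⟨omSubstLin k M, omSubstLin_sq k M⟩ g := by
  rw [ofPol_mul_ofExt]
  exact Algebra.TensorProduct.lift_tmul (ofPol k n)
    (ExteriorAlgebra.lift k ⟨omSubstLin k M, omSubstLin_sq k M⟩)
    (fun _ _ => ofPol_comm k n _ _) f g

theorem omSubst_ofPol (M : Matrix (Fin n) (Fin n) (Pol k n)) (f : Pol k n) :
    omSubst k M (ofPol k n f) = ofPol k n f := by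
  simpa using omSubst_ofPol_mul_ofExt k M f 1

theorem omSubst_omv (M : Matrix (Fin n) (Fin n) (Pol k n)) (i : Fin n) :
    omSubst k M (omv k i) = omComb k (M i) := by
  have h := omSubst_ofPol_mul_ofExt k M 1 (ExteriorAlgebra.ι k (Pi.single i 1))
  rw [map_one, one_mul, one_mul, ExteriorAlgebra.lift_ι_apply] at h
  refine h.trans ?_
  rw [omSubstLin, LinearMap.comp_apply, LinearMap.sum_apply, Finset.sum_eq_single i]
  · simp
  · intro j _ hj
    simp [hj]
  · simp

theorem omSubst_omComb (M : Matrix (Fin n) (Fin n) (Pol k n)) (p : Fin n → Pol k n) :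
    omSubst k M (omComb k p) = omComb k (Matrix.vecMul p M) := by
  rw [omComb_apply, omComb_apply, map_sum]
  simp only [map_mul, omSubst_ofPol, omSubst_omv, omComb_apply, Matrix.vecMul, dotProduct, map_sum,
    Finset.sum_mul, Finset.mul_sum, mul_assoc]
  exact Finset.sum_comm

/-- A substitution acts on rows of coefficients by multiplication from the right, hence the reversed
order of the product. -/
theorem omSubst_comp (M N : Matrix (Fin n) (Fin n) (Pol k n)) :
    (omSubst k M).comp (omSubst k N) = omSubst k (N * M) := by
  refine extPol_algHom_ext (fun i => ?_) (fun i => ?_)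
  · simp [xv, omSubst_ofPol]
  · rw [AlgHom.comp_apply, omSubst_omv, omSubst_omv, omSubst_omComb]
    rfl

theorem omComb_single (i : Fin n) : omComb k (Pi.single i 1) = omv k i := by
  rw [omComb_apply, Finset.sum_eq_single i]
  · simp
  · intro j _ hj
    simp [hj]
  · simp

theorem omSubst_one : omSubst k (1 : Matrix (Fin n) (Fin n) (Pol k n)) = AlgHom.id k _ := by
  refine extPol_algHom_ext (fun i => ?_) (fun i => ?_)
  · simp [xv, omSubst_ofPol]
  · rw [omSubst_omv, ← omComb_single, AlgHom.id_apply]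
    congr 1
    ext j : 1
    simp [Matrix.one_apply, Pi.single_apply, eq_comm]

theorem omSubst_omSubst_of_mul_eq_one {M N : Matrix (Fin n) (Fin n) (Pol k n)} (h : N * M = 1)
    (r : ExtPol k n) : omSubst k M (omSubst k N r) = r := by
  have := DFunLike.congr_fun (omSubst_comp k M N) r
  rwa [h, omSubst_one] at this

/-! ### Extension of operators from `Pol_n` to `R_n` -/

/-- The operator `φ ⊗ 1` on `R_n`. -/
def tensorEnd : Module.End k (Pol k n) →ₐ[k] Module.End k (ExtPol k n) :=
  (Module.End.rTensorAlgHom k (Pol k n) (ExteriorAlgebra k (Fin n → k)) :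
    Module.End k (Pol k n) →ₐ[k] Module.End k (Pol k n ⊗[k] ExteriorAlgebra k (Fin n → k)))

theorem tensorEnd_apply (φ : Module.End k (Pol k n)) (f : Pol k n)
    (g : ExteriorAlgebra k (Fin n → k)) :
    tensorEnd k φ (ofPol k n f * ofExt k n g) = ofPol k n (φ f) * ofExt k n g := by
  rw [ofPol_mul_ofExt, ofPol_mul_ofExt]
  exact LinearMap.rTensor_tmul _ φ g f

theorem tensorEnd_ofPol (φ : Module.End k (Pol k n)) (f : Pol k n) :
    tensorEnd k φ (ofPol k n f) = ofPol k n (φ f) := by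
  simpa using tensorEnd_apply k φ f 1

theorem tensorEnd_mulLeft (p : Pol k n) (f : ExtPol k n) :
    tensorEnd k (LinearMap.mulLeft k p) f = ofPol k n p * f := by
  induction f using extPol_induction with
  | zero => simp
  | mul a b => rw [tensorEnd_apply, LinearMap.mulLeft_apply, map_mul, mul_assoc]
  | add a b ha hb => rw [map_add, ha, hb, mul_add]

theorem tensorEnd_algHom_mul (φ : Pol k n →ₐ[k] Pol k n) (f g : ExtPol k n) :
    tensorEnd k φ.toLinearMap (f * g) =
      tensorEnd k φ.toLinearMap f * tensorEnd k φ.toLinearMap g := by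
  induction f using extPol_induction with
  | zero => simp
  | add a b ha hb => simp only [map_add, add_mul, ha, hb]
  | mul a b =>
    induction g using extPol_induction with
    | zero => simp
    | add a b ha hb => simp only [map_add, mul_add, ha, hb]
    | mul a' b' =>
      have h : ∀ p q : Pol k n, ofPol k n p * ofExt k n b * (ofPol k n q * ofExt k n b') =
          ofPol k n (p * q) * ofExt k n (b * b') := fun p q => by
        rw [map_mul, map_mul, mul_assoc, ← mul_assoc (ofExt k n b),
          ← (ofPol_comm k n q (ofExt k n b)).eq]
        simp only [mul_assoc]
      simp only [h, tensorEnd_apply, AlgHom.toLinearMap_apply, map_mul φ]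

/-- The algebra endomorphism `φ ⊗ 1` of `R_n`. -/
def tensorAlgHom (φ : Pol k n →ₐ[k] Pol k n) : ExtPol k n →ₐ[k] ExtPol k n :=
  AlgHom.ofLinearMap (tensorEnd k φ.toLinearMap)
    (by simpa using tensorEnd_ofPol k φ.toLinearMap 1) (tensorEnd_algHom_mul k φ)

theorem tensorAlgHom_omv (φ : Pol k n →ₐ[k] Pol k n) (i : Fin n) :
    tensorAlgHom k φ (omv k i) = omv k i := by
  change tensorEnd k φ.toLinearMap (ofExt k n (ExteriorAlgebra.ι k (Pi.single i 1))) = _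
  have h := tensorEnd_apply k φ.toLinearMap 1 (ExteriorAlgebra.ι k (Pi.single i 1))
  simp only [map_one, one_mul, AlgHom.toLinearMap_apply] at h
  exact h

theorem tensorAlgHom_ofPol (φ : Pol k n →ₐ[k] Pol k n) (p : Pol k n) :
    tensorAlgHom k φ (ofPol k n p) = ofPol k n (φ p) :=
  tensorEnd_ofPol k _ _

theorem tensorAlgHom_omComb (φ : Pol k n →ₐ[k] Pol k n) (p : Fin n → Pol k n) :
    tensorAlgHom k φ (omComb k p) = omComb k (fun j => φ (p j)) := by
  simp [omComb_apply, map_sum, tensorAlgHom_ofPol, tensorAlgHom_omv]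

theorem tensorEnd_derivation_mul (D : Derivation k (Pol k n) (Pol k n)) (f g : ExtPol k n) :
    tensorEnd k D.toLinearMap (f * g) =
      tensorEnd k D.toLinearMap f * g + f * tensorEnd k D.toLinearMap g := by
  induction f using extPol_induction with
  | zero => simp
  | add a b ha hb => simp only [map_add, add_mul, ha, hb]; abel
  | mul a b =>
    induction g using extPol_induction with
    | zero => simp
    | add a b ha hb => simp only [map_add, mul_add, ha, hb]; abel
    | mul a' b' =>
      have h : ∀ p q : Pol k n, ofPol k n p * ofExt k n b * (ofPol k n q * ofExt k n b') =
          ofPol k n (p * q) * ofExt k n (b * b') := fun p q => by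
        rw [map_mul, map_mul, mul_assoc, ← mul_assoc (ofExt k n b),
          ← (ofPol_comm k n q (ofExt k n b)).eq]
        simp only [mul_assoc]
      have h' : D.toLinearMap (a * a') = a * D.toLinearMap a' + a' * D.toLinearMap a :=
        D.leibniz a a'
      simp only [h, tensorEnd_apply, h']
      rw [← add_mul, ← map_add, mul_comm a', add_comm]

theorem tensorEnd_omComb (φ : Module.End k (Pol k n)) (p : Fin n → Pol k n) :
    tensorEnd k φ (omComb k p) = omComb k (fun j => φ (p j)) := by
  rw [omComb_apply, omComb_apply, map_sum]
  exact Finset.sum_congr rfl fun j _ => tensorEnd_apply k φ _ _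

/-! ### The transition matrix to invariant odd generators -/

/-- The polynomial `z ^ i ∏_{m > i} (1 + x_m z)`. -/
def esymmSeries (i : Fin n) : Polynomial (Pol k n) :=
  Polynomial.X ^ (i : ℕ) * ∏ m ∈ Finset.Ioi i, (1 + Polynomial.C (X m) * Polynomial.X)

/-- The matrix with entries the elementary symmetric polynomials
`e_{j - i}(x_{i + 1}, …, x_n)`. -/
def esymmMatrix : Matrix (Fin n) (Fin n) (Pol k n) :=
  fun i j => (esymmSeries k i).coeff j

/-- The series of index `i` begins with `z ^ i`, so the matrix is upper unitriangular. The change of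
odd generators is therefore invertible over every `k`. -/
theorem det_esymmMatrix : (esymmMatrix k (n := n)).det = 1 := by
  have hd : ∀ i, esymmMatrix k (n := n) i i = 1 := fun i => by
    rw [esymmMatrix, esymmSeries, Polynomial.coeff_X_pow_mul', if_pos le_rfl, Nat.sub_self,
      Polynomial.coeff_zero_eq_eval_zero, Polynomial.eval_prod]
    simp
  rw [Matrix.det_of_isUpperTriangular, Finset.prod_eq_one fun i _ => hd i]
  intro i j hij
  rw [esymmMatrix, esymmSeries, Polynomial.coeff_X_pow_mul', if_neg]
  exact not_le.2 hij

theorem Ioi_lo (j : Fin (n - 1)) : Finset.Ioi (lo j) = insert (hi j) (Finset.Ioi (hi j)) := by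
  ext m
  simp only [Finset.mem_Ioi, Finset.mem_insert, Fin.lt_def, Fin.ext_iff, lo, hi]
  omega

theorem swap_mem_Ioi {j : Fin (n - 1)} {i : Fin n} (h : i ≠ lo j) (m : Fin n) :
    m ∈ Finset.Ioi i ↔ Equiv.swap (lo j) (hi j) m ∈ Finset.Ioi i := by
  simp only [Finset.mem_Ioi, Equiv.swap_apply_def]
  split_ifs with h1 h2
  · subst h1
    simp only [Fin.lt_def, ne_eq, Fin.ext_iff, lo, hi] at *
    omega
  · subst h2
    simp only [Fin.lt_def, ne_eq, Fin.ext_iff, lo, hi] at *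
    omega
  · rfl

theorem esymmSeries_lo (j : Fin (n - 1)) :
    esymmSeries k (lo j) = Polynomial.X ^ (lo j : ℕ) *
      ((1 + Polynomial.C (X (hi j)) * Polynomial.X) *
        ∏ m ∈ Finset.Ioi (hi j), (1 + Polynomial.C (X m) * Polynomial.X)) := by
  rw [esymmSeries, Ioi_lo, Finset.prod_insert (by simp)]

theorem map_rename_factor (e : Equiv.Perm (Fin n)) (m : Fin n) :
    (1 + Polynomial.C (X m) * Polynomial.X : Polynomial (Pol k n)).map
      (rename e : Pol k n →ₐ[k] Pol k n).toRingHom =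
      1 + Polynomial.C (X (e m)) * Polynomial.X := by
  rw [Polynomial.map_add, Polynomial.map_mul, Polynomial.map_one, Polynomial.map_C,
    Polynomial.map_X]
  congr 3
  exact rename_X _ _

theorem esymmSeries_map_rename_of_ne {j : Fin (n - 1)} {i : Fin n} (h : i ≠ lo j) :
    (esymmSeries k i).map (rename (Equiv.swap (lo j) (hi j)) : Pol k n →ₐ[k] Pol k n).toRingHom =
      esymmSeries k i := by
  rw [esymmSeries, Polynomial.map_mul, Polynomial.map_pow, Polynomial.map_X, Polynomial.map_prod]
  congr 1
  exact Finset.prod_equiv (Equiv.swap (lo j) (hi j)) (swap_mem_Ioi h)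
    fun m _ => map_rename_factor k _ m

/-- Among the factors of index greater than `lo j`, the swap alters only the one at `hi j`,
replacing `x_{j+1}` by `x_j`. The difference `(x_j - x_{j+1}) z` supplies the extra power of `z`
that turns the remaining product into the series of index `hi j`. -/
theorem esymmSeries_map_rename_lo (j : Fin (n - 1)) :
    (esymmSeries k (lo j)).map
        (rename (Equiv.swap (lo j) (hi j)) : Pol k n →ₐ[k] Pol k n).toRingHom =
      esymmSeries k (lo j) + Polynomial.C (X (lo j) - X (hi j)) * esymmSeries k (hi j) := by
  have key : ∀ {A : Type _} [CommRing A] (P q z a b : A),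
      P * ((1 + b * z) * q) = P * ((1 + a * z) * q) + (b - a) * (P * z * q) := by
    intros; ring
  have hp : ∏ m ∈ Finset.Ioi (hi j), (1 + Polynomial.C (X m) * Polynomial.X :
        Polynomial (Pol k n)).map
          (rename (Equiv.swap (lo j) (hi j)) : Pol k n →ₐ[k] Pol k n).toRingHom =
      ∏ m ∈ Finset.Ioi (hi j), (1 + Polynomial.C (X m) * Polynomial.X) := by
    refine Finset.prod_congr rfl fun m hm => ?_
    have hm' : hi j < m := Finset.mem_Ioi.1 hm
    have hl : lo j < hi j := by simp [lo, hi, Fin.lt_def]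
    rw [map_rename_factor, Equiv.swap_apply_of_ne_of_ne (hl.trans hm').ne' hm'.ne']
  have he : esymmSeries k (hi j) = Polynomial.X ^ (lo j : ℕ) * Polynomial.X *
      ∏ m ∈ Finset.Ioi (hi j), (1 + Polynomial.C (X m) * Polynomial.X) := by
    rw [esymmSeries, ← pow_succ]
    rfl
  rw [esymmSeries_lo, Polynomial.map_mul, Polynomial.map_pow, Polynomial.map_X, Polynomial.map_mul,
    Polynomial.map_prod, map_rename_factor, hp, Equiv.swap_apply_right, he, Polynomial.C_sub]
  exact key _ _ _ _ _

/-- This is the rule for `s_j` on the `ω_i`, with `ω_i` replaced by the `i`-th row. It is the reason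
why the generators obtained by inverting the matrix are invariant. -/
theorem rename_esymmMatrix (j : Fin (n - 1)) (i l : Fin n) :
    rename (Equiv.swap (lo j) (hi j)) (esymmMatrix k i l) =
      esymmMatrix k i l +
        if i = lo j then (X (lo j) - X (hi j)) * esymmMatrix k (hi j) l else 0 := by
  split_ifs with h
  · subst h
    have h := congrArg (fun q => Polynomial.coeff q l) (esymmSeries_map_rename_lo k j)
    simp only [Polynomial.coeff_map, Polynomial.coeff_add, Polynomial.coeff_C_mul] at h
    exact h
  · have h := congrArg (fun q => Polynomial.coeff q l) (esymmSeries_map_rename_of_ne k h)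
    simp only [Polynomial.coeff_map] at h
    rw [add_zero]
    exact h

variable (n) in
/-- The derivation of `Pol_n[z]` acting as `polD` on the coefficients. -/
def polDCoeffs : Derivation k (Polynomial (Pol k n)) (Polynomial (Pol k n)) :=
  (PolynomialModule.equivPolynomialSelf (R := Pol k n)).toLinearMap.compDer (polD k n).mapCoeffs

theorem coeff_polDCoeffs (p : Polynomial (Pol k n)) (l : ℕ) :
    (polDCoeffs k n p).coeff l = polD k n (p.coeff l) := rfl

theorem polDCoeffs_linear (m : Fin n) :
    polDCoeffs k n (1 + Polynomial.C (X m) * Polynomial.X) =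
      Polynomial.C (X m ^ 2) * Polynomial.X := by
  ext1 l
  rw [coeff_polDCoeffs]
  rcases eq_or_ne l 1 with rfl | hl
  · simp only [Polynomial.coeff_add, Polynomial.coeff_one, one_ne_zero, if_false, zero_add,
      Polynomial.coeff_mul_X, Polynomial.coeff_C_zero, polD, mkDerivation_X]
  · simp only [Polynomial.coeff_add, Polynomial.coeff_C_mul, Polynomial.coeff_X, hl.symm, if_false,
      mul_zero, add_zero, Polynomial.coeff_one]
    split_ifs <;> simp

theorem polDCoeffs_X_pow (i : ℕ) :
    polDCoeffs k n (Polynomial.X ^ i) = 0 := by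
  ext1 l
  rw [coeff_polDCoeffs, Polynomial.coeff_X_pow]
  split_ifs <;> simp

theorem derivation_prod {ι R A : Type*} [DecidableEq ι] [CommRing R] [CommRing A] [Algebra R A]
    (D : Derivation R A A) (s : Finset ι) (f : ι → A) :
    D (∏ i ∈ s, f i) = ∑ i ∈ s, D (f i) * ∏ j ∈ s.erase i, f j := by
  induction s using Finset.induction_on with
  | empty => simp
  | insert a s ha ih =>
    rw [Finset.prod_insert ha, D.leibniz, ih, Finset.sum_insert ha, Finset.erase_insert ha,
      smul_eq_mul, smul_eq_mul, Finset.mul_sum, add_comm, mul_comm]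
    congr 1
    refine Finset.sum_congr rfl fun i hi => ?_
    have hia : a ≠ i := fun h => ha (h ▸ hi)
    rw [Finset.erase_insert_of_ne hia, Finset.prod_insert (by simp [ha])]
    ring

/-- Write `1 + x_m z = (1 + x_l z) + (x_m - x_l) z` in each factor with `i < m < l` and expand
according to the first `m` at which `1 + x_l z` is chosen. The term `j = l` is the one where it is
never chosen. -/
theorem sum_Ioc_telescope {A : Type*} [CommRing A] (x : Fin n → A) (z : A) {i l : Fin n}
    (hil : i < l) :
    ∑ j ∈ Finset.Ioc i l, (∏ m ∈ Finset.Ioo i j, ((x m - x l) * z)) *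
        ∏ m ∈ Finset.Ioi j, (1 + x m * z) =
      ∏ m ∈ (Finset.Ioi i).erase l, (1 + x m * z) := by
  have h := Finset.prod_add_ordered (Finset.Ioo i l) (fun m => 1 + x m * z)
    (fun _ => -(1 + x l * z))
  have e1 : ∀ m : Fin n, 1 + x m * z + -(1 + x l * z) = (x m - x l) * z := fun m => by ring
  simp only [e1] at h
  have e2 : (Finset.Ioi i).erase l = Finset.Ioo i l ∪ Finset.Ioi l := by
    ext m
    simp only [Finset.mem_erase, Finset.mem_Ioi, Finset.mem_union, Finset.mem_Ioo]
    grind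
  have e3 : Finset.Ioc i l = insert l (Finset.Ioo i l) := by
    ext m
    simp only [Finset.mem_Ioc, Finset.mem_insert, Finset.mem_Ioo]
    grind
  have d2 : Disjoint (Finset.Ioo i l) (Finset.Ioi l) :=
    Finset.disjoint_left.2 fun m h1 h2 =>
      lt_asymm (Finset.mem_Ioo.1 h1).2 (Finset.mem_Ioi.1 h2)
  -- For `j < l` the index `l` occurs in the product over `m > j`; splitting it off yields the
  -- factor `1 + x_l z` of the expansion.
  have e4 : ∀ j ∈ Finset.Ioo i l, (∏ m ∈ Finset.Ioo i j, ((x m - x l) * z)) *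
      ∏ m ∈ Finset.Ioi j, (1 + x m * z) =
      -(-(1 + x l * z) * (∏ m ∈ Finset.Ioo i l with m < j, ((x m - x l) * z)) *
        ∏ m ∈ Finset.Ioo i l with j < m, (1 + x m * z)) *
        ∏ m ∈ Finset.Ioi l, (1 + x m * z) := by
    intro j hj
    rw [Finset.mem_Ioo] at hj
    have f1 : (Finset.Ioo i l).filter (· < j) = Finset.Ioo i j := by
      ext m
      simp only [Finset.mem_filter, Finset.mem_Ioo]
      grind
    have f2 : Finset.Ioi j = insert l ((Finset.Ioo i l).filter (j < ·) ∪ Finset.Ioi l) := by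
      ext m
      simp only [Finset.mem_filter, Finset.mem_Ioo, Finset.mem_Ioi, Finset.mem_insert,
        Finset.mem_union]
      grind
    rw [f1, f2, Finset.prod_insert (by simp), Finset.prod_union]
    · ring
    · exact d2.mono_left (Finset.filter_subset _ _)
  rw [e3, Finset.sum_insert (by simp), Finset.sum_congr rfl e4, ← Finset.sum_mul,
    Finset.sum_neg_distrib, h, e2, Finset.prod_union d2]
  ring

/-- By the Leibniz rule the left side is a sum over `l > i` of `x_l² z` times the product without
its `l`-th factor. The telescoping identity expands each such product over `i < j ≤ l`, and
exchanging the sums collects the coefficient `α_{i,j}`. -/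
theorem polDCoeffs_esymmSeries (i : Fin n) :
    polDCoeffs k n (esymmSeries k i) =
      ∑ j ∈ Finset.Ioi i, Polynomial.C (alpha k i j) * esymmSeries k j := by
  have hl : ∀ l ∈ Finset.Ioi i,
      Polynomial.C (X l ^ 2 : Pol k n) * Polynomial.X *
        ∏ m ∈ (Finset.Ioi i).erase l, (1 + Polynomial.C (X m) * Polynomial.X) =
      ∑ j ∈ Finset.Ioc i l, Polynomial.C (X l ^ 2 : Pol k n) * Polynomial.X *
        ((∏ m ∈ Finset.Ioo i j, ((Polynomial.C (X m) - Polynomial.C (X l)) * Polynomial.X)) *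
        ∏ m ∈ Finset.Ioi j, (1 + Polynomial.C (X m) * Polynomial.X)) := by
    intro l hl
    rw [← sum_Ioc_telescope (fun m => Polynomial.C (X m : Pol k n)) Polynomial.X
      (Finset.mem_Ioi.1 hl), Finset.mul_sum]
  rw [esymmSeries, Derivation.leibniz, polDCoeffs_X_pow, smul_zero, add_zero, derivation_prod]
  simp only [polDCoeffs_linear, smul_eq_mul]
  rw [Finset.sum_congr rfl hl, Finset.mul_sum]
  simp only [Finset.mul_sum, alpha, map_sum, Finset.sum_mul]
  rw [Finset.sum_comm' (t' := Finset.Ioi i) (s' := fun j => Finset.Ici j)]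
  · refine Finset.sum_congr rfl fun j hj => Finset.sum_congr rfl fun l _ => ?_
    rw [Finset.prod_mul_distrib, Finset.prod_const, Fin.card_Ioo, esymmSeries]
    have hij : (i : ℕ) < j := Fin.lt_def.1 (Finset.mem_Ioi.1 hj)
    -- One `z` comes from differentiating the factor, and `j - i - 1` more from the differences with
    -- `i < m < j`; together with `z ^ i` they give the leading power of the series of index `j`.
    have hp : (Polynomial.X : Polynomial (Pol k n)) ^ (j : ℕ) =
        Polynomial.X ^ (i : ℕ) * Polynomial.X * Polynomial.X ^ ((j : ℕ) - i - 1) := by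
      rw [← pow_succ, ← pow_add]
      congr 1
      omega
    rw [hp, map_mul, map_prod]
    simp only [Polynomial.C_sub]
    ring
  · intro l j
    simp only [Finset.mem_Ioi, Finset.mem_Ioc, Finset.mem_Ici]
    grind

theorem polD_esymmMatrix (i l : Fin n) :
    polD k n (esymmMatrix k i l) = ∑ j ∈ Finset.Ioi i, alpha k i j * esymmMatrix k j l := by
  have h := congrArg (fun q => Polynomial.coeff q l) (polDCoeffs_esymmSeries k i)
  simp only [coeff_polDCoeffs, Polynomial.finsetSum_coeff, Polynomial.coeff_C_mul] at h
  exact h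

/-! ### Extension of operators from `Pol_n` to `R_n`, along the invariant odd generators -/

variable (n) in
/-- The algebra automorphism of `R_n` expressing the `ω_i` in invariant odd generators. -/
def toInvGen : ExtPol k n →ₐ[k] ExtPol k n := omSubst k (esymmMatrix k)

variable (n) in
/-- The inverse of `toInvGen`. -/
def fromInvGen : ExtPol k n →ₐ[k] ExtPol k n := omSubst k (esymmMatrix k)⁻¹

theorem fromInvGen_toInvGen (r : ExtPol k n) : fromInvGen k n (toInvGen k n r) = r :=
  omSubst_omSubst_of_mul_eq_one k
    (Matrix.mul_nonsing_inv _ (by rw [det_esymmMatrix]; exact isUnit_one)) r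

theorem toInvGen_fromInvGen (r : ExtPol k n) : toInvGen k n (fromInvGen k n r) = r :=
  omSubst_omSubst_of_mul_eq_one k
    (Matrix.nonsing_inv_mul _ (by rw [det_esymmMatrix]; exact isUnit_one)) r

variable (n) in
/-- The change of coordinates `toInvGen`, as a linear equivalence. -/
def invGenEquiv : ExtPol k n ≃ₗ[k] ExtPol k n :=
  { (fromInvGen k n).toLinearMap with
    invFun := toInvGen k n
    left_inv := toInvGen_fromInvGen k
    right_inv := fromInvGen_toInvGen k }

variable (n) in
/-- The extension of a linear operator from `Pol_n` to `R_n`, linear over the exterior algebra on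
invariant odd generators. -/
def extendEnd : Module.End k (Pol k n) →ₐ[k] Module.End k (ExtPol k n) :=
  ((invGenEquiv k n).conjAlgEquiv k).toAlgHom.comp (tensorEnd k)

theorem extendEnd_apply (φ : Module.End k (Pol k n)) (r : ExtPol k n) :
    extendEnd k n φ r = fromInvGen k n (tensorEnd k φ (toInvGen k n r)) := rfl

theorem extendEnd_ofPol (φ : Module.End k (Pol k n)) (f : Pol k n) :
    extendEnd k n φ (ofPol k n f) = ofPol k n (φ f) := by
  rw [extendEnd_apply, toInvGen, omSubst_ofPol, tensorEnd_ofPol, fromInvGen, omSubst_ofPol]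

theorem extendEnd_mulLeft (p : Pol k n) (r : ExtPol k n) :
    extendEnd k n (LinearMap.mulLeft k p) r = ofPol k n p * r := by
  rw [extendEnd_apply, tensorEnd_mulLeft, map_mul, fromInvGen_toInvGen, fromInvGen, omSubst_ofPol]

theorem extendEnd_derivation_mul (D : Derivation k (Pol k n) (Pol k n)) (f g : ExtPol k n) :
    extendEnd k n D.toLinearMap (f * g) =
      extendEnd k n D.toLinearMap f * g + f * extendEnd k n D.toLinearMap g := by
  simp only [extendEnd_apply, map_mul, tensorEnd_derivation_mul, map_add, fromInvGen_toInvGen]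

/-- In the new coordinates `s_j` acts on the polynomial factor alone. Both sides are algebra
homomorphisms after the change of coordinates, so it suffices to compare generators, where
`rename_esymmMatrix` applies. -/
theorem extendEnd_rename (j : Fin (n - 1)) :
    extendEnd k n (rename (Equiv.swap (lo j) (hi j)) : Pol k n →ₐ[k] Pol k n).toLinearMap =
      (simpleRefl k j).toLinearMap := by
  set s : Pol k n →ₐ[k] Pol k n := rename (Equiv.swap (lo j) (hi j)) with hs
  have h : (tensorAlgHom k s).comp (toInvGen k n) = (toInvGen k n).comp (simpleRefl k j) := by
    refine extPol_algHom_ext (fun i => ?_) (fun i => ?_)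
    · simp only [AlgHom.comp_apply, simpleRefl_x]
      simp [xv, toInvGen, omSubst_ofPol, tensorAlgHom_ofPol, hs]
    · have hx : xv k (lo j) - xv k (hi j) = ofPol k n (X (lo j) - X (hi j)) := by simp [xv]
      have hc : ∀ (p : Pol k n) (v : Fin n → Pol k n),
          ofPol k n p * omComb k v = omComb k (fun l => p * v l) := fun p v => by
        simp only [omComb_apply, Finset.mul_sum, map_mul, mul_assoc]
      rw [AlgHom.comp_apply, AlgHom.comp_apply, simpleRefl_om, toInvGen, map_add, omSubst_omv,
        tensorAlgHom_omComb, hs]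
      simp only [rename_esymmMatrix]
      split_ifs with h
      · rw [map_mul, hx, omSubst_ofPol, omSubst_omv, hc, ← map_add]
        rfl
      · simp only [add_zero, map_zero]
  ext r
  rw [extendEnd_apply]
  change fromInvGen k n ((tensorAlgHom k s).comp (toInvGen k n) r) = _
  rw [h, AlgHom.comp_apply, fromInvGen_toInvGen]
  rfl

theorem extendEnd_polD_omv (i : Fin n) :
    extendEnd k n (polD k n).toLinearMap (omv k i) =
      ∑ j ∈ Finset.Ioi i, ofPol k n (alpha k i j) * omv k j := by
  have h : tensorEnd k (polD k n).toLinearMap (toInvGen k n (omv k i)) =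
      toInvGen k n (∑ j ∈ Finset.Ioi i, ofPol k n (alpha k i j) * omv k j) := by
    have hc : ∀ (p : Pol k n) (v : Fin n → Pol k n),
        ofPol k n p * omComb k v = omComb k (p • v) := fun p v => by
      simp only [omComb_apply, Finset.mul_sum, map_mul, mul_assoc, Pi.smul_apply, smul_eq_mul]
    simp only [toInvGen, omSubst_omv, map_sum, map_mul, omSubst_ofPol, tensorEnd_omComb, hc]
    rw [← map_sum]
    congr 1
    ext1 l
    rw [Finset.sum_apply]
    exact polD_esymmMatrix k i l
  rw [extendEnd_apply, h, fromInvGen_toInvGen]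

/-! ### A decomposition of the identity in rings with nilHecke relations -/

section Abstract

variable {A : Type*} [Ring A]

/-- The product `T_j T_{j+1} ⋯ T_{j+l-1}`. -/
def ascProd (T : ℕ → A) : ℕ → ℕ → A
  | _, 0 => 1
  | j, l + 1 => T j * ascProd T (j + 1) l

/-- The nilHecke relations between `x_0, …, x_N` and `T_0, …, T_{N-1}`. -/
structure NilHeckeRelations (N : ℕ) (x T : ℕ → A) : Prop where
  sq : ∀ i < N, T i * T i = 0
  comm : ∀ i j, i + 1 < j → j < N → T i * T j = T j * T i
  braid : ∀ i, i + 1 < N → T i * T (i + 1) * T i = T (i + 1) * T i * T (i + 1)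
  mul_x_succ : ∀ i < N, T i * x (i + 1) = x i * T i - 1
  mul_x_of_ne : ∀ i j, i < N → j ≤ N → j ≠ i → j ≠ i + 1 → T i * x j = x j * T i

namespace NilHeckeRelations

variable {N : ℕ} {x T : ℕ → A} (h : NilHeckeRelations N x T)
include h

theorem comm_ascProd (l : ℕ) : ∀ i j, i + 1 < j → j + l ≤ N →
    T i * ascProd T j l = ascProd T j l * T i := by
  induction l with
  | zero => intros; simp [ascProd]
  | succ l ih =>
    intro i j hij hj
    rw [ascProd, ← mul_assoc, h.comm i j hij (by omega), mul_assoc,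
      ih i (j + 1) (by omega) (by omega), mul_assoc]

/-- Only the braid relation at one place and distant commutations are needed: a factor passing
through the ascending product drops its index by one. -/
theorem mul_ascProd_shift (l : ℕ) : ∀ i j, i + 1 < l → j + l ≤ N →
    T (j + i + 1) * ascProd T j l = ascProd T j l * T (j + i) := by
  induction l with
  | zero => intro i j hi; omega
  | succ l ih =>
    intro i j hi hj
    rcases i with - | i
    · obtain ⟨l, rfl⟩ : ∃ l', l = l' + 1 := ⟨l - 1, by omega⟩
      simp only [ascProd, add_zero]
      rw [← mul_assoc, ← mul_assoc, ← h.braid j (by omega), mul_assoc,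
        h.comm_ascProd l j (j + 1 + 1) (by omega) (by omega)]
      simp only [mul_assoc]
    · have e := ih i (j + 1) (by omega) (by omega)
      rw [ascProd, ← mul_assoc, ← h.comm j _ (by omega) (by omega), mul_assoc,
        show j + (i + 1) + 1 = j + 1 + i + 1 by omega, e, ← mul_assoc,
        show j + 1 + i = j + (i + 1) by omega]

/-- For `i = 0` this is `T_0² = 0`; a larger `T_i` passes through the product as `T_{i-1}` and kills
`φ`. -/
theorem mul_ascProd_mul_eq_zero {m : ℕ} (hm : m < N) {φ : A} (hφ : ∀ i < m, T i * φ = 0) :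
    ∀ i < m + 1, T i * (ascProd T 0 (m + 1) * φ) = 0 := by
  intro i hi
  rcases i with - | i
  · rw [ascProd, ← mul_assoc, ← mul_assoc, h.sq 0 (by omega), zero_mul, zero_mul]
  · have e := h.mul_ascProd_shift (m + 1) i 0 (by omega) (by omega)
    rw [zero_add] at e
    rw [← mul_assoc, e, mul_assoc, hφ i (by omega), mul_zero]

/-- Moving `x` leftwards through the product would leave one correction for each factor omitted. If
a factor other than the first is omitted, the factors before it commute past the later ones and kill
`φ`, so only the correction omitting the first factor survives. -/
theorem ascProd_mul_x (l : ℕ) : ∀ j, j + l < N → ∀ φ : A, (∀ i < j + l, T i * φ = 0) →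
    ascProd T j (l + 1) * (x (j + l + 1) * φ) =
      x j * (ascProd T j (l + 1) * φ) - ascProd T (j + 1) l * φ := by
  induction l with
  | zero =>
    intro j hj φ _
    simp only [ascProd, mul_one, add_zero, one_mul]
    rw [← mul_assoc, h.mul_x_succ j (by omega), sub_mul, one_mul, mul_assoc]
  | succ l ih =>
    intro j hj φ hφ
    have e := ih (j + 1) (by omega) φ (fun i hi => hφ i (by omega))
    rw [ascProd, mul_assoc, show j + (l + 1) + 1 = j + 1 + l + 1 by omega, e, mul_sub,
      ← mul_assoc, h.mul_x_succ j (by omega), ← mul_assoc (T j) (ascProd T (j + 1 + 1) l),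
      h.comm_ascProd l j (j + 1 + 1) (by omega) (by omega), mul_assoc _ (T j) φ,
      hφ j (by omega), mul_zero, sub_zero, sub_mul, one_mul]
    simp only [mul_assoc]

/-- The identity is a sum of products `p * φ`, where `p` is in `P`, and `φ` is in `B` and is killed
from the left by all `T_i`. -/
theorem one_mem_closure {P B : Subring A} (hxP : ∀ i ≤ N, x i ∈ P) (hxB : ∀ i ≤ N, x i ∈ B)
    (hTB : ∀ i < N, T i ∈ B) :
    (1 : A) ∈ AddSubgroup.closure
      {r | ∃ p ∈ P, ∃ φ ∈ B, (∀ i < N, T i * φ = 0) ∧ r = p * φ} := by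
  let M : ℕ → AddSubgroup A := fun m =>
    AddSubgroup.closure {r | ∃ p ∈ P, ∃ φ ∈ B, (∀ i < m, T i * φ = 0) ∧ r = p * φ}
  have hmul : ∀ m, ∀ p ∈ P, ∀ r ∈ M m, p * r ∈ M m := by
    intro m p hp r hr
    induction hr using AddSubgroup.closure_induction with
    | mem r hr =>
      obtain ⟨q, hq, φ, hφ, hT, rfl⟩ := hr
      exact AddSubgroup.subset_closure ⟨p * q, P.mul_mem hp hq, φ, hφ, hT, (mul_assoc _ _ _).symm⟩
    | zero => simp
    | add a b _ _ ha hb => rw [mul_add]; exact add_mem ha hb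
    | neg a _ ha => rw [mul_neg]; exact neg_mem ha
  have hB : ∀ l j, j + l ≤ N → ascProd T j l ∈ B := by
    intro l
    induction l with
    | zero => intros; exact B.one_mem
    | succ l ih =>
      intro j hj
      exact B.mul_mem (hTB j (by omega)) (ih (j + 1) (by omega))
  -- Induction on `j` shortens the product `T_j ⋯ T_m` from the left: `ascProd_mul_x` expresses the
  -- shorter product through longer ones, applied to `φ` and to `x_{m+1} φ`. The latter is again
  -- killed by the `T_i` with `i < m`. The empty product, at `j = m + 1`, is the case that is
  -- wanted.
  have step : ∀ m < N, ∀ j l, j + l = m + 1 → ∀ φ ∈ B, (∀ i < m, T i * φ = 0) →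
      ascProd T j l * φ ∈ M (m + 1) := by
    intro m hm j
    induction j with
    | zero =>
      rintro l hl φ hφ hT
      obtain rfl : l = m + 1 := by omega
      exact AddSubgroup.subset_closure ⟨1, P.one_mem, _, B.mul_mem (hB _ _ (by omega)) hφ,
        h.mul_ascProd_mul_eq_zero hm hT, (one_mul _).symm⟩
    | succ j ih =>
      rintro l hl φ hφ hT
      obtain rfl : m = j + l := by omega
      have e := h.ascProd_mul_x l j hm φ hT
      have e' : ascProd T (j + 1) l * φ = x j * (ascProd T j (l + 1) * φ) -
          ascProd T j (l + 1) * (x (j + l + 1) * φ) := by rw [e]; abel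
      rw [e']
      refine sub_mem (hmul _ _ (hxP j (by omega)) _ (ih _ (by omega) φ hφ hT))
        (ih _ (by omega) _ (B.mul_mem (hxB _ (by omega)) hφ) fun i hi => ?_)
      rw [← mul_assoc, h.mul_x_of_ne i _ (by omega) (by omega) (by omega) (by omega), mul_assoc,
        hT i hi, mul_zero]
  have key : ∀ m ≤ N, (1 : A) ∈ M m := by
    intro m
    induction m with
    | zero =>
      exact fun _ => AddSubgroup.subset_closure
        ⟨1, P.one_mem, 1, B.one_mem, fun i hi => absurd hi (Nat.not_lt_zero i), (one_mul 1).symm⟩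
    | succ m ih =>
      intro hm
      have h1 := ih (by omega)
      refine (AddSubgroup.closure_le (M (m + 1))).2 ?_ h1
      rintro r ⟨p, hp, φ, hφ, hT, rfl⟩
      refine hmul _ _ hp _ ?_
      simpa [ascProd] using step m (by omega) (m + 1) 0 rfl φ hφ hT
  exact key N le_rfl

end NilHeckeRelations

end Abstract

/-! ### Divided differences on `Pol_n` -/

variable (n) in
/-- The projection `R_n → Pol_n` with `ω_i ↦ 0`. -/
def polProj : ExtPol k n →ₐ[k] Pol k n :=
  (Algebra.TensorProduct.lift (AlgHom.id k (Pol k n))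
    ((Algebra.ofId k (Pol k n)).comp ExteriorAlgebra.algebraMapInv)
    (fun _ _ => Commute.all _ _) : Pol k n ⊗[k] ExteriorAlgebra k (Fin n → k) →ₐ[k] Pol k n)

theorem polProj_ofPol (p : Pol k n) : polProj k n (ofPol k n p) = p := by
  have h := Algebra.TensorProduct.lift_tmul (AlgHom.id k (Pol k n))
    ((Algebra.ofId k (Pol k n)).comp (ExteriorAlgebra.algebraMapInv (R := k) (M := Fin n → k)))
    (fun _ _ => Commute.all _ _) p 1
  refine Eq.trans h ?_
  rw [map_one, mul_one, AlgHom.id_apply]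

theorem ofPol_injective : Function.Injective (ofPol k n) :=
  Function.LeftInverse.injective (polProj_ofPol k)

/-- The automorphism of `Pol_n` exchanging `x_j` and `x_{j+1}`. -/
def polSwap (j : Fin (n - 1)) : Pol k n →ₐ[k] Pol k n := rename (Equiv.swap (lo j) (hi j))

/-- The divided difference operator on `Pol_n`. -/
def polT (j : Fin (n - 1)) : Module.End k (Pol k n) where
  toFun f := polProj k n (Tdiv k j (ofPol k n f))
  map_add' f g := by simp only [map_add]
  map_smul' c f := by
    have : Tdiv k j (ofPol k n (c • f)) = c • Tdiv k j (ofPol k n f) := by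
      rw [map_smul]
      exact (Tdiv k j).map_smul_of_tower c _
    rw [this, map_smul, RingHom.id_apply]

theorem polT_spec (j : Fin (n - 1)) (f : Pol k n) :
    (X (lo j) - X (hi j)) * polT k j f = f - polSwap k j f := by
  have h := congrArg (polProj k n) (divDiff_spec k j (ofPol k n f))
  rw [simpleRefl_ofPol] at h
  simp only [map_mul, map_sub, xv, polProj_ofPol] at h
  exact h

variable {k} in
theorem polX_sub_cancel {i j : Fin n} (h : i ≠ j) {f g : Pol k n}
    (hfg : (X i - X j) * f = (X i - X j) * g) : f = g :=
  sub_eq_zero.1 (pol_regular k h _ (by rw [mul_sub, hfg, sub_self]))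

theorem polSwap_lo (j : Fin (n - 1)) : polSwap k j (X (lo j)) = X (hi j) := by
  simp [polSwap]

theorem polSwap_hi (j : Fin (n - 1)) : polSwap k j (X (hi j)) = X (lo j) := by
  simp [polSwap]

theorem polSwap_of_ne {j : Fin (n - 1)} {i : Fin n} (h1 : i ≠ lo j) (h2 : i ≠ hi j) :
    polSwap k j (X i) = X i := by
  simp [polSwap, Equiv.swap_apply_of_ne_of_ne h1 h2]

theorem polSwap_polSwap (j : Fin (n - 1)) (f : Pol k n) : polSwap k j (polSwap k j f) = f := by
  rw [polSwap, rename_rename]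
  convert rename_id_apply f
  ext i
  simp

theorem polT_eq_zero {j : Fin (n - 1)} {f : Pol k n} (hf : polT k j f = 0) :
    polSwap k j f = f := by
  have h := polT_spec k j f
  rw [hf, mul_zero] at h
  exact (sub_eq_zero.1 h.symm).symm

theorem polSwap_polT (j : Fin (n - 1)) (f : Pol k n) : polSwap k j (polT k j f) = polT k j f := by
  refine polX_sub_cancel (lo_ne_hi j) ?_
  have h := congrArg (polSwap k j) (polT_spec k j f)
  simp only [map_mul, map_sub, polSwap_lo, polSwap_hi, polSwap_polSwap] at h
  linear_combination -h - polT_spec k j f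

theorem polT_polT (j : Fin (n - 1)) (f : Pol k n) : polT k j (polT k j f) = 0 := by
  refine polX_sub_cancel (lo_ne_hi j) ?_
  rw [polT_spec, polSwap_polT, sub_self, mul_zero]

theorem polT_X_hi (j : Fin (n - 1)) (f : Pol k n) :
    polT k j (X (hi j) * f) = X (lo j) * polT k j f - f := by
  refine polX_sub_cancel (lo_ne_hi j) ?_
  rw [polT_spec, map_mul, polSwap_hi]
  linear_combination -X (lo j) * polT_spec k j f

theorem polT_X_of_ne {j : Fin (n - 1)} {i : Fin n} (h1 : i ≠ lo j) (h2 : i ≠ hi j)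
    (f : Pol k n) : polT k j (X i * f) = X i * polT k j f := by
  refine polX_sub_cancel (lo_ne_hi j) ?_
  rw [polT_spec, map_mul, polSwap_of_ne k h1 h2]
  linear_combination -X i * polT_spec k j f

theorem lo_ne_lo {i j : Fin (n - 1)} (h : (i : ℕ) ≠ j) : lo i ≠ lo j := by
  simpa [lo, Fin.ext_iff] using h

theorem hi_ne_hi {i j : Fin (n - 1)} (h : (i : ℕ) ≠ j) : hi i ≠ hi j := by
  simpa [hi, Fin.ext_iff] using h

theorem lo_ne_hi' {i j : Fin (n - 1)} (h : (i : ℕ) ≠ j + 1) : lo i ≠ hi j := by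
  simpa [lo, hi, Fin.ext_iff] using h

theorem polSwap_comm {i j : Fin (n - 1)} (h : (i : ℕ) + 1 < j) (f : Pol k n) :
    polSwap k i (polSwap k j f) = polSwap k j (polSwap k i f) := by
  have hc : Equiv.swap (lo i) (hi i) * Equiv.swap (lo j) (hi j) =
      Equiv.swap (lo j) (hi j) * Equiv.swap (lo i) (hi i) :=
    (Equiv.Perm.Disjoint.commute (by
      rw [Equiv.Perm.disjoint_iff_disjoint_support, Equiv.Perm.support_swap (lo_ne_hi i),
        Equiv.Perm.support_swap (lo_ne_hi j)]
      simp only [Finset.disjoint_left, Finset.mem_insert, Finset.mem_singleton, Fin.ext_iff, lo, hi]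
      omega)).eq
  rw [polSwap, polSwap, rename_rename, rename_rename, ← Equiv.Perm.coe_mul, hc,
    Equiv.Perm.coe_mul]

/-- After clearing denominators the right side is symmetric in `i` and `j`, as distant swaps
commute. -/
theorem polT_polT_aux {i j : Fin (n - 1)} (h : (i : ℕ) + 1 < j ∨ (j : ℕ) + 1 < i) (f : Pol k n) :
    (X (lo i) - X (hi i)) * ((X (lo j) - X (hi j)) * polT k i (polT k j f)) =
      f - polSwap k j f - polSwap k i f + polSwap k i (polSwap k j f) := by
  have h1 := polT_spec k i (polT k j f)
  have h2 := polT_spec k j f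
  have h3 := congrArg (polSwap k i) h2
  rw [map_mul, map_sub, map_sub, polSwap_of_ne k (lo_ne_lo (by omega)) (lo_ne_hi' (by omega)),
    polSwap_of_ne k (lo_ne_hi' (by omega)).symm (hi_ne_hi (by omega))] at h3
  linear_combination (X (lo j) - X (hi j)) * h1 + h2 - h3

theorem polT_comm {i j : Fin (n - 1)} (h : (i : ℕ) + 1 < j) (f : Pol k n) :
    polT k i (polT k j f) = polT k j (polT k i f) := by
  refine polX_sub_cancel (lo_ne_hi j) (polX_sub_cancel (lo_ne_hi i) ?_)
  have h1 := polT_polT_aux k (Or.inl h) f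
  have h2 := polT_polT_aux k (Or.inr h) f
  have h3 := polSwap_comm k h f
  linear_combination h1 - h2 + h3

theorem polSwap_braid {i j : Fin (n - 1)} (h : (j : ℕ) = i + 1) (f : Pol k n) :
    polSwap k i (polSwap k j (polSwap k i f)) = polSwap k j (polSwap k i (polSwap k j f)) := by
  have hij : hi i = lo j := by simp [hi, lo, h]
  have h1 : lo i ≠ lo j := lo_ne_lo (by omega)
  have h2 : lo i ≠ hi j := lo_ne_hi' (by omega)
  have h3 := lo_ne_hi j
  simp only [polSwap, rename_rename, hij]
  congr 1
  congr 1
  ext m : 1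
  simp only [Function.comp_apply, Equiv.swap_apply_def]
  split_ifs <;> simp_all

/-- With `a`, `b`, `c` the three differences of variables, clearing denominators turns `w = T_s T_t
T_s f` into the alternating sum of `f` over the six permutations. Exchanging `s` and `t` changes
only the last term, where `sts = tst`. The additional factor `a` on both sides arises from the
division by `a` in `u`, and is cancelled where the lemma is applied. -/
theorem divDiff_braid_aux {R : Type*} [CommRing R] (s t : R →+* R) {a b c f u v w : R}
    (hc : c = a + b) (sa : s a = -a) (sb : s b = c) (sc : s c = b) (ta : t a = c)
    (hs : s (s f) = f) (hu : a * u = f - s f) (hv : b * v = u - t u) (hw : a * w = v - s v) :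
    a * (a * (b * (c * w))) =
      a * (f - s f - t f + t (s f) + s (t f) - s (t (s f))) := by
  have h1 := congrArg t hu
  simp only [map_mul, map_sub, ta] at h1
  have h2 : a * b * c * v = c * (f - s f) - a * (t f - t (s f)) := by
    linear_combination a * c * hv + c * hu - a * h1
  have h3 := congrArg s h2
  simp only [map_mul, map_sub, sa, sb, sc, hs] at h3
  linear_combination a * b * c * hw + h2 + h3 + (f - s f) * hc

theorem polT_braid {i j : Fin (n - 1)} (h : (j : ℕ) = i + 1) (f : Pol k n) :
    polT k i (polT k j (polT k i f)) = polT k j (polT k i (polT k j f)) := by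
  have hij : hi i = lo j := by simp [hi, lo, h]
  have h1 : lo i ≠ lo j := lo_ne_lo (by omega)
  have h2 : lo i ≠ hi j := lo_ne_hi' (by omega)
  have si := polSwap_lo k i
  have si' := polSwap_hi k i
  have sj := polSwap_lo k j
  have sj' := polSwap_hi k j
  have sij : polSwap k i (X (hi j)) = X (hi j) := polSwap_of_ne k h2.symm (hij ▸ (lo_ne_hi j).symm)
  have sji : polSwap k j (X (lo i)) = X (lo i) := polSwap_of_ne k h1 h2
  rw [hij] at si si'
  have hu := fun f => polT_spec k i f
  have hv := fun f => polT_spec k j f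
  simp only [hij] at hu
  have e1 := polX_sub_cancel h1 (divDiff_braid_aux (polSwap k i : Pol k n →+* Pol k n)
    (polSwap k j : Pol k n →+* Pol k n) (f := f) (a := X (lo i) - X (lo j))
    (b := X (lo j) - X (hi j)) (c := X (lo i) - X (hi j)) (by ring) (by simp [si, si'])
    (by simp [si', sij]) (by simp [si, sij]) (by simp [sj, sji]) (polSwap_polSwap k i f)
    (hu f) (hv _) (hu _))
  have e2 := polX_sub_cancel (lo_ne_hi j) (divDiff_braid_aux (polSwap k j : Pol k n →+* Pol k n)
    (polSwap k i : Pol k n →+* Pol k n) (f := f) (b := X (lo i) - X (lo j))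
    (a := X (lo j) - X (hi j)) (c := X (lo i) - X (hi j)) (by ring) (by simp [sj, sj'])
    (by simp [sj, sji]) (by simp [sj', sji]) (by simp [si', sij]) (polSwap_polSwap k j f)
    (hv f) (hu _) (hv _))
  simp only [RingHom.coe_coe] at e1 e2
  refine polX_sub_cancel h1 (polX_sub_cancel (lo_ne_hi j) (polX_sub_cancel h2 ?_))
  linear_combination e1 - e2 - polSwap_braid k h f

/-! ### The nilHecke relations on `Pol_n` -/

variable (n) in
/-- Multiplication by `x_{i+1}` on `Pol_n`, or `0` if there is no such variable. -/
def natX (i : ℕ) : Module.End k (Pol k n) :=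
  if h : i < n then LinearMap.mulLeft k (X ⟨i, h⟩) else 0

variable (n) in
/-- The divided difference `T_{i+1}` on `Pol_n`, or `0` if there is no such operator. -/
def natT (i : ℕ) : Module.End k (Pol k n) :=
  if h : i < n - 1 then polT k ⟨i, h⟩ else 0

theorem nilHeckeRelations : NilHeckeRelations (n - 1) (natX k n) (natT k n) where
  sq i hi := by
    refine LinearMap.ext fun f => ?_
    simp [natT, hi, polT_polT]
  comm i j hij hj := by
    refine LinearMap.ext fun f => ?_
    simpa [natT, hj, show i < n - 1 by omega] using
      polT_comm k (i := ⟨i, by omega⟩) (j := ⟨j, hj⟩) hij f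
  braid i hi := by
    refine LinearMap.ext fun f => ?_
    simpa [natT, hi, show i < n - 1 by omega] using
      polT_braid k (i := ⟨i, by omega⟩) (j := ⟨i + 1, hi⟩) rfl f
  mul_x_succ i hi := by
    refine LinearMap.ext fun f => ?_
    simp only [natT, natX, hi, show i + 1 < n by omega, show i < n by omega, dif_pos]
    exact polT_X_hi k ⟨i, hi⟩ f
  mul_x_of_ne i j hi hj h1 h2 := by
    refine LinearMap.ext fun f => ?_
    simpa [natT, natX, hi, show j < n by omega] using
      polT_X_of_ne k (j := ⟨i, hi⟩) (i := ⟨j, by omega⟩) (by simpa [lo, Fin.ext_iff] using h1)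
        (by simpa [EnhancedNilHecke.hi, Fin.ext_iff] using h2) f

theorem mem_symmetricSubalgebra_of_polSwap {f : Pol k n} (h : ∀ j, polSwap k j f = f) :
    f ∈ symmetricSubalgebra (Fin n) k := by
  rw [mem_symmetricSubalgebra]
  intro e
  rcases n with - | n
  · rw [Subsingleton.elim e 1]
    exact rename_id_apply f
  have he : e ∈ Submonoid.closure
      (Set.range fun i : Fin n => Equiv.swap i.castSucc i.succ) := by
    rw [Equiv.Perm.mclosure_swap_castSucc_succ]
    trivial
  induction he using Submonoid.closure_induction with
  | mem e he =>
    obtain ⟨i, rfl⟩ := he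
    exact h i
  | one => exact rename_id_apply f
  | mul e e' _ _ h1 h2 =>
    rw [Equiv.Perm.coe_mul, ← rename_rename, h2, h1]

variable (n) in
/-- The algebra of operators on `Pol_n` generated by the `x_i` and the `T_j`. -/
def polOps : Subalgebra k (Module.End k (Pol k n)) :=
  Algebra.adjoin k
    (Set.range (fun i => LinearMap.mulLeft k (X i)) ∪ Set.range (polT k))

/-- The identity of `Pol_n` is a sum of operators `p * φ`, where `p` is a polynomial and `φ` is an
element of `polOps` with symmetric values. -/
theorem one_mem_closure_polOps :
    (1 : Module.End k (Pol k n)) ∈ AddSubgroup.closure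
      {r | ∃ p : Pol k n, ∃ φ ∈ polOps k n, (∀ j, (polSwap k j).toLinearMap * φ = φ) ∧
        r = LinearMap.mulLeft k p * φ} := by
  have h := (nilHeckeRelations k (n := n)).one_mem_closure
    (P := (Algebra.lmul k (Pol k n)).range.toSubring) (B := (polOps k n).toSubring) ?_ ?_ ?_
  · refine AddSubgroup.closure_mono ?_ h
    rintro r ⟨_, ⟨p, rfl⟩, φ, hφ, hT, rfl⟩
    refine ⟨p, φ, hφ, fun j => LinearMap.ext fun f => polT_eq_zero k ?_, rfl⟩
    have := DFunLike.congr_fun (hT j j.2) f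
    simpa [natT] using this
  · intro i _
    rw [natX]
    split_ifs with hi
    · exact ⟨X ⟨i, hi⟩, rfl⟩
    -- This case occurs for `n = 0`, where the bound `i ≤ n - 1` still admits `i = 0`.
    · exact Subring.zero_mem _
  · intro i _
    rw [natX]
    split_ifs with hi
    · exact Algebra.subset_adjoin (Or.inl ⟨⟨i, hi⟩, rfl⟩)
    · exact Subring.zero_mem _
  · intro i hi
    rw [natT, dif_pos hi]
    exact Algebra.subset_adjoin (Or.inr ⟨⟨i, hi⟩, rfl⟩)

/-! ### Generators of `A_n` -/

variable (n) in
/-- The elements of `A_n` as `k`-linear operators on `R_n`. -/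
def toEnd : EnhNilHecke k n →ₐ[k] Module.End k (ExtPol k n) where
  toFun ξ := ξ.restrictScalars k
  map_one' := rfl
  map_mul' _ _ := rfl
  map_zero' := rfl
  map_add' _ _ := rfl
  commutes' _ := rfl

theorem toEnd_apply (ξ : EnhNilHecke k n) (f : ExtPol k n) : toEnd k n ξ f = ξ f := rfl

theorem toEnd_injective : Function.Injective (toEnd k n) := fun _ _ h =>
  LinearMap.ext fun f => DFunLike.congr_fun h f

theorem apply_mul_invariant (ξ : EnhNilHecke k n) (f : ExtPol k n) {r : ExtPol k n}
    (hr : r ∈ invariants k n) : ξ (f * r) = ξ f * r :=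
  ξ.map_smul (⟨MulOpposite.op r, hr⟩ : (invariants k n).op) f

variable {k} in
/-- A `k`-linear operator on `R_n` commuting with multiplication by invariants from the right, as
an element of `A_n`. -/
def ofInvLinear (ψ : Module.End k (ExtPol k n))
    (h : ∀ f, ∀ r ∈ invariants k n, ψ (f * r) = ψ f * r) : EnhNilHecke k n where
  toFun := ψ
  map_add' := map_add ψ
  map_smul' c f := h f _ c.2

variable (n) in
/-- The subalgebra of `A_n` generated by the `x_i`, the `ω_i` and the `T_j`. -/
def genAlg : Subalgebra k (EnhNilHecke k n) :=
  Algebra.adjoin k (Set.range (Xop k) ∪ Set.range (Omop k) ∪ Set.range (Tdiv k))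

/-- Both operators solve the same equation after multiplication by `x_j - x_{j+1}`, which is a
regular element of `R_n`. -/
theorem extendEnd_polT (j : Fin (n - 1)) : extendEnd k n (polT k j) = toEnd k n (Tdiv k j) := by
  refine LinearMap.ext fun f => divDiff_unique k j ?_
  have hp : xv k (lo j) - xv k (hi j) = ofPol k n (X (lo j) - X (hi j)) := by simp [xv]
  have h : LinearMap.mulLeft k (X (lo j) - X (hi j)) * polT k j = 1 - (polSwap k j).toLinearMap :=
    LinearMap.ext fun f => polT_spec k j f
  have h' := DFunLike.congr_fun (congrArg (extendEnd k n) h) f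
  rw [map_mul, map_sub, map_one, polSwap, extendEnd_rename, Module.End.mul_apply,
    extendEnd_mulLeft, ← hp] at h'
  exact h'.trans (divDiff_spec k j f).symm

theorem exists_genAlg_of_polOps {φ : Module.End k (Pol k n)} (hφ : φ ∈ polOps k n) :
    ∃ η ∈ genAlg k n, toEnd k n η = extendEnd k n φ := by
  have h : polOps k n ≤ ((genAlg k n).map (toEnd k n)).comap (extendEnd k n) := by
    refine Algebra.adjoin_le ?_
    rintro _ (⟨i, rfl⟩ | ⟨j, rfl⟩)
    · refine ⟨Xop k i, Algebra.subset_adjoin (Or.inl (Or.inl ⟨i, rfl⟩)), ?_⟩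
      exact LinearMap.ext fun f => (extendEnd_mulLeft k (X i) f).symm
    · exact ⟨Tdiv k j, Algebra.subset_adjoin (Or.inr ⟨j, rfl⟩), (extendEnd_polT k j).symm⟩
  exact h hφ

theorem mulL_mem_genAlg (r : ExtPol k n) : mulL k n r ∈ genAlg k n := by
  have h : Algebra.adjoin k (Set.range (xv k) ∪ Set.range (omv k)) ≤
      (genAlg k n).comap (mulL k n) := by
    refine Algebra.adjoin_le ?_
    rintro _ (⟨i, rfl⟩ | ⟨i, rfl⟩)
    · exact Algebra.subset_adjoin (Or.inl (Or.inl ⟨i, rfl⟩))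
    · exact Algebra.subset_adjoin (Or.inl (Or.inr ⟨i, rfl⟩))
  rw [adjoin_xv_omv] at h
  exact h (Algebra.mem_top (x := r))

theorem extendEnd_mem_invariants {φ : Module.End k (Pol k n)}
    (hφ : ∀ j, (polSwap k j).toLinearMap * φ = φ) (f : ExtPol k n) :
    extendEnd k n φ f ∈ invariants k n := by
  rw [mem_invariants]
  intro j
  have h := DFunLike.congr_fun (congrArg (extendEnd k n) (hφ j)) f
  rwa [map_mul, polSwap, extendEnd_rename] at h

/-- Multiplying the decomposition `1 = ∑ p φ` by `ξ` gives `ξ = ∑ ξ(p) φ`, with `ξ(p)` a left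
multiplication and `φ` generated by the `x_i` and `T_j`. -/
theorem genAlg_eq_top : genAlg k n = ⊤ := by
  refine eq_top_iff.2 fun ξ _ => ?_
  have key : ∀ r ∈ AddSubgroup.closure {r : Module.End k (Pol k n) | ∃ p : Pol k n,
      ∃ φ ∈ polOps k n, (∀ j, (polSwap k j).toLinearMap * φ = φ) ∧ r = LinearMap.mulLeft k p * φ},
      ∃ η ∈ genAlg k n, toEnd k n η = toEnd k n ξ * extendEnd k n r := by
    intro r hr
    induction hr using AddSubgroup.closure_induction with
    | mem r hr =>
      obtain ⟨p, φ, hφ, hs, rfl⟩ := hr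
      obtain ⟨η, hη, e⟩ := exists_genAlg_of_polOps k hφ
      -- The value `φ(f)` is invariant, so `ξ(p φ(f)) = ξ(p) φ(f)`.
      refine ⟨mulL k n (ξ (ofPol k n p)) * η, mul_mem (mulL_mem_genAlg k _) hη, ?_⟩
      refine LinearMap.ext fun f => ?_
      rw [map_mul, e, map_mul, Module.End.mul_apply, Module.End.mul_apply, Module.End.mul_apply,
        extendEnd_mulLeft, toEnd_apply k ξ, apply_mul_invariant k ξ _
        (extendEnd_mem_invariants k hs f)]
      rfl
    | zero => exact ⟨0, zero_mem _, by simp⟩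
    | add a b _ _ ha hb =>
      obtain ⟨η, hη, e⟩ := ha
      obtain ⟨η', hη', e'⟩ := hb
      exact ⟨η + η', add_mem hη hη', by rw [map_add, map_add, mul_add, e, e']⟩
    | neg a _ ha =>
      obtain ⟨η, hη, e⟩ := ha
      exact ⟨-η, neg_mem hη, by
        rw [map_neg, map_neg, e]
        exact LinearMap.ext fun f => (map_neg (toEnd k n ξ) (extendEnd k n a f)).symm⟩
  obtain ⟨η, hη, e⟩ := key 1 (one_mem_closure_polOps k)
  rw [map_one, mul_one] at e
  rwa [← toEnd_injective k e]

/-! ### The inclusion of the nilHecke algebra -/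

variable (n) in
/-- The elements of `nh_n` as `k`-linear operators on `Pol_n`. -/
def nilHeckeToEnd : NilHecke k n →ₐ[k] Module.End k (Pol k n) where
  toFun ξ := ξ.restrictScalars k
  map_one' := rfl
  map_mul' _ _ := rfl
  map_zero' := rfl
  map_add' _ _ := rfl
  commutes' _ := rfl

/-- Linearity over symmetric polynomials does not formally give linearity over all invariants of
`R_n`. It does for left multiplications and for the `T_j`, and the decomposition `ξ = ∑ ξ(p) φ`
reduces `ξ` to these. -/
theorem extendEnd_mul_invariant (ξ : NilHecke k n) (f : ExtPol k n) (r : ExtPol k n)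
    (hr : r ∈ invariants k n) :
    extendEnd k n (nilHeckeToEnd k n ξ) (f * r) = extendEnd k n (nilHeckeToEnd k n ξ) f * r := by
  have key : ∀ u ∈ AddSubgroup.closure {r : Module.End k (Pol k n) | ∃ p : Pol k n,
      ∃ φ ∈ polOps k n, (∀ j, (polSwap k j).toLinearMap * φ = φ) ∧ r = LinearMap.mulLeft k p * φ},
      extendEnd k n (nilHeckeToEnd k n ξ * u) (f * r) =
        extendEnd k n (nilHeckeToEnd k n ξ * u) f * r := by
    intro u hu
    induction hu using AddSubgroup.closure_induction with
    | mem u hu =>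
      obtain ⟨p, φ, hφ, hs, rfl⟩ := hu
      obtain ⟨η, -, e⟩ := exists_genAlg_of_polOps k hφ
      have h : nilHeckeToEnd k n ξ * (LinearMap.mulLeft k p * φ) = LinearMap.mulLeft k (ξ p) * φ := by
        refine LinearMap.ext fun g => ?_
        have hg : φ g ∈ symmetricSubalgebra (Fin n) k :=
          mem_symmetricSubalgebra_of_polSwap k fun j => DFunLike.congr_fun (hs j) g
        have := ξ.map_smul ⟨φ g, hg⟩ p
        rw [Subalgebra.smul_def, Subalgebra.smul_def, smul_eq_mul, smul_eq_mul, mul_comm,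
          mul_comm (φ g)] at this
        exact this
      rw [h, map_mul (extendEnd k n), Module.End.mul_apply, Module.End.mul_apply, extendEnd_mulLeft,
        extendEnd_mulLeft, ← e, toEnd_apply, toEnd_apply, apply_mul_invariant k η f hr, mul_assoc]
    | zero => simp
    | add a b _ _ ha hb =>
      rw [mul_add, map_add, LinearMap.add_apply, LinearMap.add_apply, ha, hb, add_mul]
    | neg a _ ha =>
      have h : nilHeckeToEnd k n ξ * -a = -(nilHeckeToEnd k n ξ * a) :=
        LinearMap.ext fun f => map_neg (nilHeckeToEnd k n ξ) (a f)
      rw [h, map_neg, LinearMap.neg_apply, LinearMap.neg_apply, ha, neg_mul]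
  simpa using key 1 (one_mem_closure_polOps k)

variable (n) in
/-- The inclusion of the nilHecke algebra into the enhanced nilHecke algebra. -/
def nilHeckeIncl : NilHecke k n →ₐ[k] EnhNilHecke k n where
  toFun ξ := ofInvLinear (extendEnd k n (nilHeckeToEnd k n ξ)) (extendEnd_mul_invariant k ξ)
  map_one' := toEnd_injective k (by
    change extendEnd k n (nilHeckeToEnd k n 1) = _
    simp only [map_one])
  map_mul' ξ η := toEnd_injective k (by
    change extendEnd k n (nilHeckeToEnd k n (ξ * η)) = _
    rw [map_mul, map_mul, map_mul]
    rfl)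
  map_zero' := toEnd_injective k (by
    change extendEnd k n (nilHeckeToEnd k n 0) = _
    simp only [map_zero])
  map_add' ξ η := toEnd_injective k (by
    change extendEnd k n (nilHeckeToEnd k n (ξ + η)) = _
    rw [map_add, map_add, map_add]
    rfl)
  commutes' c := toEnd_injective k (by
    change extendEnd k n (nilHeckeToEnd k n (algebraMap k _ c)) = _
    rw [AlgHom.commutes, AlgHom.commutes, AlgHom.commutes])

theorem toEnd_nilHeckeIncl (ξ : NilHecke k n) :
    toEnd k n (nilHeckeIncl k n ξ) = extendEnd k n (nilHeckeToEnd k n ξ) := rfl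

theorem nilHeckeIncl_ofPol (ξ : NilHecke k n) (f : Pol k n) :
    nilHeckeIncl k n ξ (ofPol k n f) = ofPol k n (ξ f) :=
  extendEnd_ofPol k _ f

theorem nilHeckeIncl_injective : Function.Injective (nilHeckeIncl k n) := fun ξ η h =>
  LinearMap.ext fun f => ofPol_injective k (by
    rw [← nilHeckeIncl_ofPol, ← nilHeckeIncl_ofPol, h])

/-! ### The derivation -/

variable (n) in
/-- The even derivation of `R_n` extending `polD`, with `ω_i ↦ ∑_{j > i} α_{i,j} ω_j`. -/
def extD : Module.End k (ExtPol k n) := extendEnd k n (polD k n).toLinearMap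

theorem extD_mul (f g : ExtPol k n) : extD k n (f * g) = extD k n f * g + f * extD k n g :=
  extendEnd_derivation_mul k _ f g

theorem polD_polSwap (j : Fin (n - 1)) (f : Pol k n) :
    polD k n (polSwap k j f) = polSwap k j (polD k n f) := by
  induction f using MvPolynomial.induction_on with
  | C c => simp [polD, polSwap]
  | add p q hp hq => simp only [map_add, hp, hq]
  | mul_X p i hp =>
    simp only [map_mul, Derivation.leibniz, hp, smul_eq_mul, map_add]
    simp [polD, polSwap]

theorem extD_simpleRefl (j : Fin (n - 1)) (f : ExtPol k n) :
    extD k n (simpleRefl k j f) = simpleRefl k j (extD k n f) := by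
  have h : (polD k n).toLinearMap * (polSwap k j).toLinearMap =
      (polSwap k j).toLinearMap * (polD k n).toLinearMap :=
    LinearMap.ext fun f => polD_polSwap k j f
  have h' := DFunLike.congr_fun (congrArg (extendEnd k n) h) f
  rwa [map_mul, map_mul, polSwap, extendEnd_rename] at h'

theorem extD_mem_invariants {r : ExtPol k n} (hr : r ∈ invariants k n) :
    extD k n r ∈ invariants k n := by
  rw [mem_invariants] at hr ⊢
  intro j
  rw [← extD_simpleRefl, hr j]

theorem extendEnd_twistedD (α : Fin n → k) (f : ExtPol k n) :
    extendEnd k n (twistedD k α) f = extD k n f + ofPol k n (∑ i, C (α i) * X i) * f := by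
  rw [twistedD, map_add, LinearMap.add_apply, extendEnd_mulLeft]
  rfl

theorem extendEnd_twistedD_mul (α : Fin n → k) (f g : ExtPol k n) :
    extendEnd k n (twistedD k α) (f * g) =
      extendEnd k n (twistedD k α) f * g + f * extD k n g := by
  rw [extendEnd_twistedD, extendEnd_twistedD, extD_mul, add_mul, mul_assoc]
  abel

/-- The commutator with the operator extending `D_α`, as a map from `A_n` to itself. -/
def commD (α : Fin n → k) : EnhNilHecke k n →ₗ[k] EnhNilHecke k n where
  toFun ξ := ofInvLinear
    (extendEnd k n (twistedD k α) * toEnd k n ξ - toEnd k n ξ * extendEnd k n (twistedD k α))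
    (fun f r hr => by
      -- The twisted Leibniz rule produces `ξ(f) D(r)` in both terms, `D(r)` being again invariant,
      -- and these cancel.
      simp only [LinearMap.sub_apply, Module.End.mul_apply, toEnd_apply]
      rw [apply_mul_invariant k ξ f hr, extendEnd_twistedD_mul, extendEnd_twistedD_mul, map_add,
        apply_mul_invariant k ξ _ hr, apply_mul_invariant k ξ _ (extD_mem_invariants k hr), sub_mul]
      abel)
  map_add' ξ η := toEnd_injective k (by
    change _ * toEnd k n (ξ + η) - toEnd k n (ξ + η) * _ =
      (_ * toEnd k n ξ - toEnd k n ξ * _) + (_ * toEnd k n η - toEnd k n η * _)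
    rw [map_add, mul_add, add_mul]
    abel)
  map_smul' c ξ := toEnd_injective k (by
    change _ * toEnd k n (c • ξ) - toEnd k n (c • ξ) * _ =
      c • (_ * toEnd k n ξ - toEnd k n ξ * _)
    rw [map_smul, mul_smul_comm, smul_mul_assoc, smul_sub])

theorem toEnd_commD (α : Fin n → k) (ξ : EnhNilHecke k n) :
    toEnd k n (commD k α ξ) =
      extendEnd k n (twistedD k α) * toEnd k n ξ - toEnd k n ξ * extendEnd k n (twistedD k α) :=
  rfl

theorem commD_apply (α : Fin n → k) (ξ : EnhNilHecke k n) (f : ExtPol k n) :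
    commD k α ξ f = extendEnd k n (twistedD k α) (ξ f) - ξ (extendEnd k n (twistedD k α) f) :=
  rfl

theorem commD_mul (α : Fin n → k) (ξ η : EnhNilHecke k n) :
    commD k α (ξ * η) = commD k α ξ * η + ξ * commD k α η :=
  LinearMap.ext fun f => by
    simp only [commD_apply, LinearMap.add_apply, Module.End.mul_apply, map_sub]
    abel

/-- The twist is multiplication by a polynomial, which is central in `R_n`, so only the derivation
part of the operator contributes. -/
theorem commD_mulL (α : Fin n → k) (r : ExtPol k n) :
    commD k α (mulL k n r) = mulL k n (extD k n r) := by
  refine LinearMap.ext fun f => ?_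
  rw [commD_apply]
  change extendEnd k n (twistedD k α) (r * f) - r * extendEnd k n (twistedD k α) f = extD k n r * f
  rw [extendEnd_twistedD, extendEnd_twistedD, extD_mul, mul_add, ← mul_assoc, ← mul_assoc,
    (ofPol_comm k n _ r).eq]
  abel

theorem commD_nilHeckeIncl (α : Fin n → k) (ξ : NilHecke k n) :
    commD k α (nilHeckeIncl k n ξ) = nilHeckeIncl k n (khovanovQi k α ξ) := by
  refine toEnd_injective k ?_
  rw [toEnd_commD, toEnd_nilHeckeIncl, toEnd_nilHeckeIncl, ← map_mul, ← map_mul, ← map_sub]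
  rfl

/-- The Khovanov–Qi derivation depends only on the differences of the `α_i`. -/
theorem khovanovQi_eq_of_sub_eq {α β : Fin n → k}
    (h : ∀ j : Fin (n - 1), α (hi j) - α (lo j) = β (hi j) - β (lo j)) :
    khovanovQi k α = khovanovQi k β := by
  obtain ⟨c, hc⟩ : ∃ c, ∀ i, α i = β i + c := by
    rcases n with - | n
    · exact ⟨0, fun i => i.elim0⟩
    · refine ⟨α 0 - β 0, fun i => ?_⟩
      induction i using Fin.induction with
      | zero => ring
      | succ i ih =>
        have := h i
        change α i.succ - α i.castSucc = β i.succ - β i.castSucc at this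
        linear_combination this + ih
  -- The two operators differ by multiplication with this symmetric polynomial, which commutes with
  -- all of `nh_n`.
  have hs : (C c * ∑ i, X i : Pol k n) ∈ symmetricSubalgebra (Fin n) k := by
    rw [mem_symmetricSubalgebra]
    intro e
    rw [map_mul, map_sum, rename_C]
    simp only [rename_X]
    rw [Equiv.sum_comp e (fun i => (X i : Pol k n))]
  have ht : ∀ f, twistedD k α f = twistedD k β f +
      (⟨_, hs⟩ : symmetricSubalgebra (Fin n) k) • f := fun f => by
    simp only [twistedD, LinearMap.add_apply, LinearMap.mulLeft_apply, Subalgebra.smul_def,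
      smul_eq_mul, hc, map_add, add_mul, Finset.sum_add_distrib, Finset.mul_sum]
    ring
  refine LinearMap.ext fun ξ => LinearMap.ext fun f => ?_
  change twistedD k α (ξ f) - ξ (twistedD k α f) = twistedD k β (ξ f) - ξ (twistedD k β f)
  rw [ht, ht, map_add, map_smul]
  abel

/-- All operators involved are extended from `Pol_n`, so the identity is checked there, after
multiplication by `x_j - x_{j+1}`. -/
theorem commD_Tdiv {a : k} {α : Fin n → k} (j : Fin (n - 1)) (hα : α (hi j) - α (lo j) = a) :
    commD k α (Tdiv k j) =
      a • (1 : EnhNilHecke k n) - (a + 1) • (Xop k (lo j) * Tdiv k j)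
        + (a - 1) • (Xop k (hi j) * Tdiv k j) := by
  have h : twistedD k α * polT k j - polT k j * twistedD k α =
      a • (1 : Module.End k (Pol k n)) - (a + 1) • (LinearMap.mulLeft k (X (lo j)) * polT k j)
        + (a - 1) • (LinearMap.mulLeft k (X (hi j)) * polT k j) := by
    refine LinearMap.ext fun f => polX_sub_cancel (lo_ne_hi j) ?_
    simp only [LinearMap.sub_apply, LinearMap.add_apply, Module.End.mul_apply, LinearMap.smul_apply,
      LinearMap.mulLeft_apply, Module.End.one_apply, twistedD, Derivation.coeFn_coe,
      smul_eq_C_mul, map_add, map_sub, map_one]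
    have h0 := polT_spec k j f
    have h1 := polT_spec k j (polD k n f)
    have h2 := polT_spec k j ((∑ i, C (α i) * X i) * f)
    have h3 := congrArg (polD k n) h0
    -- This is where `a` enters: the swap changes the twist by `(α_{j+1} - α_j)(x_j - x_{j+1})`.
    have hsum : polSwap k j (∑ i, C (α i) * X i) =
        (∑ i, C (α i) * X i) + C a * (X (lo j) - X (hi j)) := by
      have e1 : ∀ i, polSwap k j (C (α i) * X i) = C (α i) * X i +
          ((if i = lo j then C (α (lo j)) * (X (hi j) - X (lo j)) else 0) +
          (if i = hi j then C (α (hi j)) * (X (lo j) - X (hi j)) else 0)) := by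
        intro i
        rw [map_mul, polSwap, rename_C]
        change _ * polSwap k j (X i) = _
        by_cases hl : i = lo j
        · subst hl
          rw [polSwap_lo, if_pos rfl, if_neg (lo_ne_hi j)]
          ring
        by_cases hh : i = hi j
        · subst hh
          rw [polSwap_hi, if_pos rfl, if_neg hl]
          ring
        · rw [polSwap_of_ne k hl hh, if_neg hl, if_neg hh]
          ring
      rw [map_sum, Finset.sum_congr rfl fun i _ => e1 i, Finset.sum_add_distrib,
        Finset.sum_add_distrib, Finset.sum_ite_eq', Finset.sum_ite_eq', if_pos (Finset.mem_univ _),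
        if_pos (Finset.mem_univ _), ← hα, map_sub]
      ring
    rw [map_mul (polSwap k j), hsum] at h2
    rw [Derivation.leibniz, map_sub, map_sub, polD_polSwap] at h3
    have hX : ∀ i, polD k n (X i) = X i ^ 2 := fun i => by simp [polD]
    simp only [smul_eq_mul, hX] at h3
    generalize (∑ i, C (α i) * X i : Pol k n) = m at *
    linear_combination h3 - h1 - h2 + (m + C a * (X (lo j) - X (hi j))) * h0
  refine toEnd_injective k ?_
  have h' := congrArg (extendEnd k n) h
  have hm : ∀ i, extendEnd k n (LinearMap.mulLeft k (X i)) = toEnd k n (Xop k i) := fun i =>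
    LinearMap.ext fun f => extendEnd_mulLeft k (X i) f
  simp only [map_sub, map_add, map_mul, map_smul, map_one, extendEnd_polT, hm] at h'
  simpa only [toEnd_commD, map_sub, map_add, map_mul, map_smul, map_one] using h'

theorem isEnhancedDerivation_commD {a : k} {α : Fin n → k}
    (hα : ∀ j : Fin (n - 1), α (hi j) - α (lo j) = a) :
    IsEnhancedDerivation k a (commD k α) where
  leibniz := commD_mul k α
  map_X i := by
    rw [Xop, commD_mulL, ← map_pow]
    congr 1
    rw [extD, xv, extendEnd_ofPol, ← map_pow]
    congr 1
    exact mkDerivation_X _ _ _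
  map_Om i := by
    simp only [Omop]
    rw [commD_mulL, extD, extendEnd_polD_omv, map_sum]
    simp only [map_mul]
  map_T j := commD_Tdiv k j (hα j)

variable {k} in
theorem IsEnhancedDerivation.unique {a : k} {d d' : EnhNilHecke k n →ₗ[k] EnhNilHecke k n}
    (h : IsEnhancedDerivation k a d) (h' : IsEnhancedDerivation k a d') : d' = d := by
  have one : ∀ {d : EnhNilHecke k n →ₗ[k] EnhNilHecke k n}, IsEnhancedDerivation k a d →
      d 1 = 0 := fun {d} h => by
    have := h.leibniz 1 1
    rwa [mul_one, mul_one, one_mul, left_eq_add] at this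
  refine LinearMap.ext fun ξ => ?_
  have hξ : ξ ∈ genAlg k n := by
    rw [genAlg_eq_top]
    trivial
  induction hξ using Algebra.adjoin_induction with
  | mem ξ hξ =>
    rcases hξ with (⟨i, rfl⟩ | ⟨i, rfl⟩) | ⟨j, rfl⟩
    · rw [h.map_X, h'.map_X]
    · rw [h.map_Om, h'.map_Om]
    · rw [h.map_T, h'.map_T]
  | algebraMap c => rw [Algebra.algebraMap_eq_smul_one, map_smul, map_smul, one h, one h']
  | add a b _ _ ha hb => rw [map_add, map_add, ha, hb]
  | mul a b _ _ ha hb => rw [h.leibniz, h'.leibniz, ha, hb]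

/-! ### The grading of `R_n` -/

theorem extPolDeg_eq (t : ℤ) :
    extPolDeg k n t = Submodule.span k {r | ∃ (m : Fin n →₀ ℕ) (l : List (Fin n)),
      2 * (∑ i, (m i : ℤ)) - (l.map fun i : Fin n => 2 * ((i : ℤ) + 1)).sum = t ∧
        r = ofPol k n (monomial m 1) * (l.map (omv k)).prod} := by
  have h : ∀ l : List (Fin n), (l.map fun i => 2 * ((i : ℤ) + 1)).sum =
      (l.map fun i : Fin n => 2 * ((i : ℤ) + 1)).sum := by
    intro l
    induction l with
    | nil => rfl
    | cons i l ih =>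
      rw [List.map_cons, List.sum_cons, ← ih]
      rfl
  simp only [extPolDeg, h]

theorem monomial_mul_prod_mul (m m' : Fin n →₀ ℕ) (l l' : List (Fin n)) :
    ofPol k n (monomial m 1) * (l.map (omv k)).prod *
        (ofPol k n (monomial m' 1) * (l'.map (omv k)).prod) =
      ofPol k n (monomial (m + m') 1) * ((l ++ l').map (omv k)).prod := by
  have h : (monomial (m + m') 1 : Pol k n) = monomial m 1 * monomial m' 1 := by
    rw [monomial_mul, one_mul]
  rw [List.map_append, List.prod_append, h, map_mul, mul_assoc,
    ← mul_assoc (l.map (omv k)).prod, ← (ofPol_comm k n _ (l.map (omv k)).prod).eq]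
  simp only [mul_assoc]

instance extPolDeg_gradedMonoid : SetLike.GradedMonoid (extPolDeg k n) where
  one_mem := by
    rw [extPolDeg_eq]
    exact Submodule.subset_span ⟨0, [], by simp, by simp⟩
  mul_mem s t f g hf hg := by
    rw [extPolDeg_eq] at hf hg ⊢
    induction hf using Submodule.span_induction with
    | zero => rw [zero_mul]; exact zero_mem _
    | add a b _ _ ha hb => rw [add_mul]; exact add_mem ha hb
    | smul c a _ ha => rw [smul_mul_assoc]; exact Submodule.smul_mem _ c ha
    | mem f hf =>
      obtain ⟨m, l, rfl, rfl⟩ := hf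
      induction hg using Submodule.span_induction with
      | zero => rw [mul_zero]; exact zero_mem _
      | add a b _ _ ha hb => rw [mul_add]; exact add_mem ha hb
      | smul c a _ ha => rw [mul_smul_comm]; exact Submodule.smul_mem _ c ha
      | mem g hg =>
        obtain ⟨m', l', rfl, rfl⟩ := hg
        refine Submodule.subset_span ⟨m + m', l ++ l', ?_, monomial_mul_prod_mul k m m' l l'⟩
        simp only [Finsupp.add_apply, Nat.cast_add, Finset.sum_add_distrib, List.map_append,
          List.sum_append]
        ring

theorem xv_mem_extPolDeg (i : Fin n) : xv k i ∈ extPolDeg k n 2 := by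
  rw [extPolDeg_eq]
  refine Submodule.subset_span ⟨Finsupp.single i 1, [], ?_, ?_⟩
  · simp [Finsupp.single_apply]
  · rw [List.map_nil, List.prod_nil, mul_one]
    rfl

theorem omv_mem_extPolDeg (i : Fin n) : omv k i ∈ extPolDeg k n (-(2 * ((i : ℤ) + 1))) := by
  rw [extPolDeg_eq]
  refine Submodule.subset_span ⟨0, [i], ?_, ?_⟩
  · simp
  · simp

/-- A multiplicative family of submodules containing the generators in the right degrees contains
the homogeneous parts of `R_n`. -/
theorem extPolDeg_le (Q : ℤ → Submodule k (ExtPol k n)) (one : 1 ∈ Q 0)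
    (mul : ∀ s t, ∀ f ∈ Q s, ∀ g ∈ Q t, f * g ∈ Q (s + t)) (hx : ∀ i, xv k i ∈ Q 2)
    (hom : ∀ i : Fin n, omv k i ∈ Q (-(2 * ((i : ℤ) + 1)))) (t : ℤ) : extPolDeg k n t ≤ Q t := by
  rw [extPolDeg_eq]
  refine Submodule.span_le.2 ?_
  rintro _ ⟨m, l, rfl, rfl⟩
  rw [sub_eq_add_neg]
  refine mul _ _ _ ?_ _ ?_
  · induction m using Finsupp.induction_linear with
    | zero => simpa using one
    | add m m' h h' =>
      have := mul _ _ _ h _ h'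
      rw [← map_mul, monomial_mul, one_mul] at this
      convert this using 1
      simp only [Finsupp.add_apply, Nat.cast_add, Finset.sum_add_distrib]
      congr 1
      ring
    | single i a =>
      have hp : ∀ a : ℕ, xv k i ^ a ∈ Q (2 * a) := by
        intro a
        induction a with
        | zero => simpa using one
        | succ a ih =>
          rw [pow_succ, Nat.cast_succ, mul_add, mul_one]
          exact mul _ _ _ ih _ (hx i)
      have e : ofPol k n (monomial (Finsupp.single i a) 1) = xv k i ^ a := by
        rw [xv, ← map_pow, X_pow_eq_monomial]
      rw [e, Finset.sum_eq_single i]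
      · simpa using hp a
      · intro j _ hj
        simp [hj.symm]
      · simp
  · induction l with
    | nil => simpa using one
    | cons i l ih =>
      rw [List.map_cons, List.sum_cons, List.map_cons, List.prod_cons, neg_add]
      exact mul _ _ _ (hom i) _ ih

theorem exists_coe_extPolDeg (f : ExtPol k n) :
    ∃ x, DirectSum.coeAlgHom (extPolDeg k n) x = f := by
  have h : Algebra.adjoin k (Set.range (xv k) ∪ Set.range (omv k)) ≤
      (DirectSum.coeAlgHom (extPolDeg k n)).range := by
    refine Algebra.adjoin_le ?_
    rintro _ (⟨i, rfl⟩ | ⟨i, rfl⟩)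
    · exact ⟨DirectSum.of (fun t => extPolDeg k n t) 2 ⟨_, xv_mem_extPolDeg k i⟩,
        DirectSum.coeAlgHom_of _ _ _⟩
    · exact ⟨DirectSum.of (fun t => extPolDeg k n t) _ ⟨_, omv_mem_extPolDeg k i⟩,
        DirectSum.coeAlgHom_of _ _ _⟩
  rw [adjoin_xv_omv] at h
  exact h (Algebra.mem_top (x := f))

/-- Elements of `A_n` are determined by their values on homogeneous elements. -/
theorem eq_of_forall_extPolDeg {ξ η : EnhNilHecke k n}
    (h : ∀ t, ∀ f ∈ extPolDeg k n t, ξ f = η f) : ξ = η := by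
  refine LinearMap.ext fun f => ?_
  obtain ⟨x, rfl⟩ := exists_coe_extPolDeg k f
  induction x using DirectSum.induction_on with
  | zero => rw [map_zero, map_zero, map_zero]
  | of t f => rw [DirectSum.coeAlgHom_of, h t f f.2]
  | add x y hx hy => rw [map_add, map_add, hx, hy, map_add]

variable (n) in
/-- The homomorphism `Pol_n → R_n[ℤ]` marking the degree. -/
def degPol : Pol k n →ₐ[k] AddMonoidAlgebra (ExtPol k n) ℤ :=
  (AddMonoidAlgebra.mapAlgHom ℤ (ofPol k n)).comp
    (aeval fun i => (AddMonoidAlgebra.single 2 (X i) : AddMonoidAlgebra (Pol k n) ℤ))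

theorem degPol_comm (p : Pol k n) (y : AddMonoidAlgebra (ExtPol k n) ℤ) :
    Commute (degPol k n p) y := by
  rw [degPol, AlgHom.comp_apply]
  induction (aeval fun i => (AddMonoidAlgebra.single 2 (X i) : AddMonoidAlgebra (Pol k n) ℤ)) p
    using AddMonoidAlgebra.induction_linear with
  | zero => rw [map_zero]; exact Commute.zero_left _
  | add a b ha hb => rw [map_add]; exact ha.add_left hb
  | single m q =>
    induction y using AddMonoidAlgebra.induction_linear with
    | zero => exact Commute.zero_right _
    | add a b ha hb => exact ha.add_right hb
    | single m' f =>
      rw [AddMonoidAlgebra.mapAlgHom_single, Commute, SemiconjBy,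
        AddMonoidAlgebra.single_mul_single, AddMonoidAlgebra.single_mul_single,
        (ofPol_comm k n q f).eq, add_comm]

variable (n) in
/-- The linear map on the span of the `ω_i` marking the degree. -/
def degOmLin : (Fin n → k) →ₗ[k] AddMonoidAlgebra (ExtPol k n) ℤ :=
  ∑ i : Fin n, (LinearMap.proj i).smulRight
    (AddMonoidAlgebra.single (-(2 * ((i : ℤ) + 1))) (omv k i))

theorem degOmLin_sq (m : Fin n → k) : degOmLin k n m * degOmLin k n m = 0 := by
  have h : degOmLin k n m = ∑ i : Fin n, m i •
      (AddMonoidAlgebra.single (-(2 * ((i : ℤ) + 1))) (omv k i) :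
        AddMonoidAlgebra (ExtPol k n) ℤ) := by
    simp [degOmLin, LinearMap.sum_apply]
  rw [h]
  induction (Finset.univ : Finset (Fin n)) using Finset.induction_on with
  | empty => simp
  | insert i s hi ih =>
    rw [Finset.sum_insert hi, add_mul, mul_add (m i • _) (m i • _), mul_add (∑ i ∈ s, _), ih,
      add_zero, Finset.mul_sum, Finset.sum_mul, smul_mul_smul_comm,
      AddMonoidAlgebra.single_mul_single, omv_mul_self,
      AddMonoidAlgebra.single_zero, smul_zero, zero_add, ← Finset.sum_add_distrib]
    refine Finset.sum_eq_zero fun j _ => ?_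
    rw [smul_mul_smul_comm, smul_mul_smul_comm, AddMonoidAlgebra.single_mul_single,
      AddMonoidAlgebra.single_mul_single, mul_comm (m j), ← smul_add,
      add_comm (-(2 * ((j : ℤ) + 1))), ← AddMonoidAlgebra.single_add, omv_mul_omv_add,
      AddMonoidAlgebra.single_zero, smul_zero]

variable (n) in
/-- The homomorphism `R_n → R_n[ℤ]` marking the degree. -/
def degHom : ExtPol k n →ₐ[k] AddMonoidAlgebra (ExtPol k n) ℤ :=
  (Algebra.TensorProduct.lift (degPol k n)
    (ExteriorAlgebra.lift k ⟨degOmLin k n, degOmLin_sq k⟩)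
    (fun _ _ => degPol_comm k _ _) :
      Pol k n ⊗[k] ExteriorAlgebra k (Fin n → k) →ₐ[k] AddMonoidAlgebra (ExtPol k n) ℤ)

theorem degHom_ofPol_mul_ofExt (f : Pol k n) (g : ExteriorAlgebra k (Fin n → k)) :
    degHom k n (ofPol k n f * ofExt k n g) =
      degPol k n f * ExteriorAlgebra.lift k ⟨degOmLin k n, degOmLin_sq k⟩ g := by
  rw [ofPol_mul_ofExt]
  exact Algebra.TensorProduct.lift_tmul (degPol k n)
    (ExteriorAlgebra.lift k ⟨degOmLin k n, degOmLin_sq k⟩) (fun _ _ => degPol_comm k _ _) f g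

theorem degHom_xv (i : Fin n) : degHom k n (xv k i) = AddMonoidAlgebra.single 2 (xv k i) := by
  have h := degHom_ofPol_mul_ofExt k (X i : Pol k n) 1
  rw [map_one, mul_one, map_one, mul_one] at h
  refine h.trans ?_
  rw [degPol, AlgHom.comp_apply, aeval_X, AddMonoidAlgebra.mapAlgHom_single]
  rfl

theorem degHom_omv (i : Fin n) :
    degHom k n (omv k i) = AddMonoidAlgebra.single (-(2 * ((i : ℤ) + 1))) (omv k i) := by
  have h := degHom_ofPol_mul_ofExt k (1 : Pol k n) (ExteriorAlgebra.ι k (Pi.single i 1))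
  rw [map_one, one_mul, map_one, one_mul, ExteriorAlgebra.lift_ι_apply] at h
  refine h.trans ?_
  rw [degOmLin, LinearMap.sum_apply, Finset.sum_eq_single i]
  · simp
  · intro j _ hj
    simp [hj]
  · simp

/-- The elements on which `degHom` has this form are closed under products and contain the
generators. Thus `degHom` separates degrees without a basis of `R_n`. -/
theorem degHom_of_mem {t : ℤ} {f : ExtPol k n} (hf : f ∈ extPolDeg k n t) :
    degHom k n f = AddMonoidAlgebra.single t f := by
  let Q : ℤ → Submodule k (ExtPol k n) := fun t =>
    { carrier := {f | degHom k n f = AddMonoidAlgebra.single t f}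
      add_mem' := fun {f g} hf hg => by
        change degHom k n (f + g) = _
        rw [map_add, hf, hg, AddMonoidAlgebra.single_add]
      zero_mem' := by
        change degHom k n 0 = _
        rw [map_zero, AddMonoidAlgebra.single_zero]
      smul_mem' := fun c f hf => by
        change degHom k n (c • f) = _
        rw [map_smul, hf, AddMonoidAlgebra.smul_single] }
  refine extPolDeg_le k Q ?_ ?_ (degHom_xv k) (degHom_omv k) t hf
  · change degHom k n 1 = _
    rw [map_one]
    rfl
  · intro s t f hf g hg
    change degHom k n (f * g) = _
    rw [map_mul, hf, hg, AddMonoidAlgebra.single_mul_single]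

/-! ### The grading of `A_n` -/

instance enhDeg_gradedMonoid : SetLike.GradedMonoid (enhDeg k n) where
  one_mem t f hf := by rwa [add_zero]
  mul_mem i j ξ η hξ hη t f hf := by
    have h := hξ _ _ (hη t f hf)
    rwa [add_assoc, add_comm j i] at h

theorem mulL_mem_enhDeg {s : ℤ} {r : ExtPol k n} (hr : r ∈ extPolDeg k n s) :
    mulL k n r ∈ enhDeg k n s := fun t f hf => by
  rw [add_comm]
  exact SetLike.mul_mem_graded hr hf

theorem divDiff_mul (j : Fin (n - 1)) (f g : ExtPol k n) :
    divDiff k j (f * g) = divDiff k j f * g + simpleRefl k j f * divDiff k j g := by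
  refine divDiff_unique k j ?_
  have hc : ∀ r, (xv k (lo j) - xv k (hi j)) * r = r * (xv k (lo j) - xv k (hi j)) := fun r => by
    have hp : xv k (lo j) - xv k (hi j) = ofPol k n (X (lo j) - X (hi j)) := by simp [xv]
    rw [hp]
    exact ofPol_comm k n _ r
  rw [mul_add, ← mul_assoc, ← mul_assoc, hc (simpleRefl k j f), mul_assoc (simpleRefl k j f),
    divDiff_spec, divDiff_spec, divDiff_spec, map_mul, sub_mul, mul_sub]
  abel

theorem divDiff_eq {j : Fin (n - 1)} {f g : ExtPol k n}
    (h : (xv k (lo j) - xv k (hi j)) * g = f - simpleRefl k j f) : divDiff k j f = g :=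
  divDiff_unique k j ((divDiff_spec k j f).trans h.symm)

theorem Tdiv_mem_enhDeg (j : Fin (n - 1)) : Tdiv k j ∈ enhDeg k n (-2) := by
  let S : ℤ → Submodule k (ExtPol k n) := fun t =>
    (extPolDeg k n t).comap (simpleRefl k j).toLinearMap
  let Q : ℤ → Submodule k (ExtPol k n) := fun t =>
    -- The rule `T(fg) = T(f) g + s(f) T(g)` also involves `s_j`, so the degree of `s_j(f)` has to
    -- be controlled in the same induction.
    extPolDeg k n t ⊓ S t ⊓ (extPolDeg k n (t + -2)).comap (toEnd k n (Tdiv k j))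
  have key : ∀ t, extPolDeg k n t ≤ Q t := by
    refine extPolDeg_le k Q ⟨⟨SetLike.one_mem_graded (extPolDeg k n), ?_⟩, ?_⟩ ?_ (fun i => ?_)
      (fun i => ?_)
    · change simpleRefl k j 1 ∈ extPolDeg k n _
      rw [map_one]
      exact SetLike.one_mem_graded (extPolDeg k n)
    · change divDiff k j 1 ∈ extPolDeg k n _
      rw [divDiff_eq k (g := 0) (by rw [map_one, sub_self, mul_zero])]
      exact zero_mem _
    · rintro s t f ⟨⟨hf, hf'⟩, hf''⟩ g ⟨⟨hg, hg'⟩, hg''⟩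
      refine ⟨⟨SetLike.mul_mem_graded (A := extPolDeg k n) hf hg, ?_⟩, ?_⟩
      · change simpleRefl k j (f * g) ∈ extPolDeg k n _
        rw [map_mul]
        exact SetLike.mul_mem_graded hf' hg'
      · change divDiff k j (f * g) ∈ extPolDeg k n _
        rw [divDiff_mul]
        refine add_mem ?_ ?_
        · have := SetLike.mul_mem_graded (A := extPolDeg k n) hf'' hg
          rwa [show s + t + -2 = s + -2 + t by ring]
        · have := SetLike.mul_mem_graded (A := extPolDeg k n) hf' hg''
          rwa [add_assoc]
    · refine ⟨⟨xv_mem_extPolDeg k i, ?_⟩, ?_⟩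
      · change simpleRefl k j (xv k i) ∈ extPolDeg k n _
        rw [simpleRefl_x]
        exact xv_mem_extPolDeg k _
      · change divDiff k j (xv k i) ∈ extPolDeg k n 0
        have one : (1 : ExtPol k n) ∈ extPolDeg k n 0 := SetLike.one_mem_graded (extPolDeg k n)
        by_cases h1 : i = lo j
        · subst h1
          rwa [divDiff_eq k (g := 1) (by rw [simpleRefl_x, Equiv.swap_apply_left, mul_one])]
        by_cases h2 : i = hi j
        · subst h2
          rw [divDiff_eq k (g := -1) (by
            rw [simpleRefl_x, Equiv.swap_apply_right, mul_neg, mul_one, neg_sub])]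
          exact neg_mem one
        · rw [divDiff_eq k (g := 0) (by
            rw [simpleRefl_x, Equiv.swap_apply_of_ne_of_ne h1 h2, mul_zero, sub_self])]
          exact zero_mem _
    · have hom := omv_mem_extPolDeg k i
      by_cases h : i = lo j
      · subst h
        have hlh : ((hi j : Fin n) : ℤ) = (lo j : Fin n) + 1 := by simp [lo, hi]
        have homh := omv_mem_extPolDeg k (hi j)
        refine ⟨⟨hom, ?_⟩, ?_⟩
        · change simpleRefl k j (omv k (lo j)) ∈ extPolDeg k n _
          rw [simpleRefl_om, if_pos rfl]
          refine add_mem hom ?_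
          have := SetLike.mul_mem_graded (A := extPolDeg k n)
            (sub_mem (xv_mem_extPolDeg k (lo j)) (xv_mem_extPolDeg k (hi j))) homh
          rw [hlh] at this
          convert this using 2
          ring
        · change divDiff k j (omv k (lo j)) ∈ extPolDeg k n _
          rw [divDiff_eq k (g := -omv k (hi j)) (by
            rw [simpleRefl_om, if_pos rfl, mul_neg]; abel)]
          refine neg_mem ?_
          rw [hlh] at homh
          convert homh using 2
          ring
      · refine ⟨⟨hom, ?_⟩, ?_⟩
        · change simpleRefl k j (omv k i) ∈ extPolDeg k n _
          rwa [simpleRefl_om, if_neg h, add_zero]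
        · change divDiff k j (omv k i) ∈ extPolDeg k n _
          rw [divDiff_eq k (g := 0) (by
            rw [simpleRefl_om, if_neg h, add_zero, mul_zero, sub_self])]
          exact zero_mem _
  exact fun t f hf => (key t hf).2

/-- This recovers each component of `y` from the sum of its components, and so gives the
independence of the homogeneous parts of `A_n`. -/
theorem degHom_coe_apply (y : DirectSum ℤ fun s => enhDeg k n s) {t : ℤ} {f : ExtPol k n}
    (hf : f ∈ extPolDeg k n t) (s : ℤ) :
    (degHom k n (DirectSum.coeAlgHom (enhDeg k n) y f)).coeff (t + s) =
      (y s : EnhNilHecke k n) f := by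
  induction y using DirectSum.induction_on with
  | zero => simp
  | of i ξ =>
    rw [DirectSum.coeAlgHom_of, degHom_of_mem k (ξ.2 t f hf), AddMonoidAlgebra.coeff_single,
      Finsupp.single_apply]
    by_cases h : i = s
    · subst h
      rw [if_pos rfl, DirectSum.of_eq_same]
    · rw [if_neg (by omega), DirectSum.of_eq_of_ne _ _ _ (Ne.symm h)]
      rfl
  | add x y hx hy =>
    rw [map_add (DirectSum.coeAlgHom _), LinearMap.add_apply, map_add (degHom k n),
      AddMonoidAlgebra.coeff_add, Finsupp.add_apply, hx, hy, DirectSum.add_apply]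
    rfl

/-- Independence comes from `degHom_coe_apply`. The sum is everything because `A_n` is generated by
homogeneous elements. -/
theorem enhDeg_isInternal : DirectSum.IsInternal (enhDeg k n) := by
  constructor
  · intro y y' h
    refine DFinsupp.ext fun s => Subtype.ext (eq_of_forall_extPolDeg k fun t f hf => ?_)
    rw [← degHom_coe_apply k y hf s, ← degHom_coe_apply k y' hf s]
    have h' : DirectSum.coeAlgHom (enhDeg k n) y = DirectSum.coeAlgHom (enhDeg k n) y' := h
    rw [h']
  · intro ξ
    have h : genAlg k n ≤ (DirectSum.coeAlgHom (enhDeg k n)).range := by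
      refine Algebra.adjoin_le ?_
      rintro _ ((⟨i, rfl⟩ | ⟨i, rfl⟩) | ⟨j, rfl⟩)
      · exact ⟨DirectSum.of (fun t => enhDeg k n t) _ ⟨_, mulL_mem_enhDeg k (xv_mem_extPolDeg k i)⟩,
          DirectSum.coeAlgHom_of _ _ _⟩
      · exact ⟨DirectSum.of (fun t => enhDeg k n t) _
          ⟨_, mulL_mem_enhDeg k (omv_mem_extPolDeg k i)⟩, DirectSum.coeAlgHom_of _ _ _⟩
      · exact ⟨DirectSum.of (fun t => enhDeg k n t) _ ⟨_, Tdiv_mem_enhDeg k j⟩,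
          DirectSum.coeAlgHom_of _ _ _⟩
    rw [genAlg_eq_top] at h
    exact h (Algebra.mem_top (x := ξ))

theorem ofPol_alpha_mem_extPolDeg (i j : Fin n) (hij : i < j) :
    ofPol k n (alpha k i j) ∈ extPolDeg k n (2 * ((j : ℤ) - i) + 2) := by
  have hprod : ∀ (l : Fin n) (s : Finset (Fin n)),
      ofPol k n (∏ m ∈ s, (X m - X l)) ∈ extPolDeg k n (2 * s.card) := by
    intro l s
    induction s using Finset.induction_on with
    | empty =>
      rw [Finset.prod_empty, map_one]
      exact SetLike.one_mem_graded (extPolDeg k n)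
    | insert m s hm ih =>
      rw [Finset.prod_insert hm, map_mul, map_sub, Finset.card_insert_of_notMem hm]
      have := SetLike.mul_mem_graded (A := extPolDeg k n)
        (sub_mem (xv_mem_extPolDeg k m) (xv_mem_extPolDeg k l)) ih
      have hd : (2 * ((s.card + 1 : ℕ) : ℤ)) = 2 + 2 * s.card := by
        push_cast
        ring
      rw [hd]
      exact this
  rw [alpha, map_sum]
  refine sum_mem fun l _ => ?_
  rw [map_mul, map_pow, sq]
  have h := SetLike.mul_mem_graded (A := extPolDeg k n) (SetLike.mul_mem_graded
    (xv_mem_extPolDeg k l) (xv_mem_extPolDeg k l)) (hprod l (Finset.Ioo i j))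
  have hd : 2 * ((j : ℤ) - i) + 2 = 2 + 2 + 2 * (Finset.Ioo i j).card := by
    have : (i : ℕ) < j := hij
    rw [Fin.card_Ioo]
    omega
  rw [hd]
  exact h

theorem extD_mem_extPolDeg {t : ℤ} {f : ExtPol k n} (hf : f ∈ extPolDeg k n t) :
    extD k n f ∈ extPolDeg k n (t + 2) := by
  let Q : ℤ → Submodule k (ExtPol k n) := fun t =>
    extPolDeg k n t ⊓ (extPolDeg k n (t + 2)).comap (extD k n)
  refine (extPolDeg_le k Q ⟨SetLike.one_mem_graded (extPolDeg k n), ?_⟩ ?_ (fun i => ?_)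
    (fun i => ?_) t hf).2
  · have h := extD_mul k (1 : ExtPol k n) 1
    rw [mul_one, mul_one, one_mul, left_eq_add] at h
    change extD k n 1 ∈ extPolDeg k n _
    rw [h]
    exact zero_mem _
  · rintro s t f ⟨hf, hf'⟩ g ⟨hg, hg'⟩
    refine ⟨SetLike.mul_mem_graded (A := extPolDeg k n) hf hg, ?_⟩
    change extD k n (f * g) ∈ extPolDeg k n _
    rw [extD_mul]
    refine add_mem ?_ ?_
    · have := SetLike.mul_mem_graded (A := extPolDeg k n) hf' hg
      rwa [show s + t + 2 = s + 2 + t by ring]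
    · have := SetLike.mul_mem_graded (A := extPolDeg k n) hf hg'
      rwa [add_assoc]
  · refine ⟨xv_mem_extPolDeg k i, ?_⟩
    change extD k n (xv k i) ∈ extPolDeg k n _
    have h : extD k n (xv k i) = xv k i * xv k i := by
      rw [extD, xv, extendEnd_ofPol, ← map_mul, ← sq]
      exact congrArg _ (mkDerivation_X _ _ _)
    rw [h]
    exact SetLike.mul_mem_graded (xv_mem_extPolDeg k i) (xv_mem_extPolDeg k i)
  · refine ⟨omv_mem_extPolDeg k i, ?_⟩
    change extD k n (omv k i) ∈ extPolDeg k n _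
    rw [extD, extendEnd_polD_omv]
    refine sum_mem fun j hj => ?_
    have := SetLike.mul_mem_graded (A := extPolDeg k n)
      (ofPol_alpha_mem_extPolDeg k i j (Finset.mem_Ioi.1 hj)) (omv_mem_extPolDeg k j)
    convert this using 2
    ring

theorem commD_mem_enhDeg (α : Fin n → k) {s : ℤ} {ξ : EnhNilHecke k n} (hξ : ξ ∈ enhDeg k n s) :
    commD k α ξ ∈ enhDeg k n (s + 2) := by
  have hp : ofPol k n (∑ i, C (α i) * X i) ∈ extPolDeg k n 2 := by
    rw [map_sum]
    refine sum_mem fun i _ => ?_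
    rw [← smul_eq_C_mul, map_smul]
    exact Submodule.smul_mem _ _ (xv_mem_extPolDeg k i)
  have hD : ∀ t, ∀ f ∈ extPolDeg k n t,
      extendEnd k n (twistedD k α) f ∈ extPolDeg k n (t + 2) := by
    intro t f hf
    rw [extendEnd_twistedD]
    refine add_mem (extD_mem_extPolDeg k hf) ?_
    rw [add_comm]
    exact SetLike.mul_mem_graded hp hf
  intro t f hf
  rw [commD_apply]
  refine sub_mem ?_ ?_
  · have := hD _ _ (hξ t f hf)
    rwa [add_assoc] at this
  · have := hξ _ _ (hD t f hf)
    rwa [show t + (s + 2) = t + 2 + s by ring]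

/-! ### Nilpotency in characteristic `p` -/

/-- Left and right multiplication by `D` commute, so modulo `p` the `p`-th power of their difference
involves only their `p`-th powers, which vanish with `D ^ p`. -/
theorem iterate_commutator_eq_zero {R : Type*} [Ring R] {p : ℕ} (hp : p.Prime) (hR : (p : R) = 0)
    {D : R} (hD : D ^ p = 0) (x : R) : (fun y => D * y - y * D)^[p] x = 0 := by
  have hc' : Commute (LinearMap.mulLeft ℤ D) (LinearMap.mulRight ℤ D) :=
    LinearMap.ext fun c => (mul_assoc D c D).symm
  have hc := hc'.neg_right
  obtain ⟨r, hr⟩ := hc.exists_add_pow_prime_eq hp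
  have h0 : (p : Module.End ℤ R) = 0 := by
    refine LinearMap.ext fun y => ?_
    change (p : Module.End ℤ R) y = 0
    rw [Module.End.natCast_apply, nsmul_eq_mul, hR, zero_mul]
  rw [neg_pow, LinearMap.pow_mulLeft, LinearMap.pow_mulRight, hD, h0, LinearMap.mulLeft_zero_eq_zero,
    LinearMap.mulRight_zero_eq_zero, mul_zero, add_zero, zero_mul, zero_mul, zero_mul,
    add_zero] at hr
  have h := DFunLike.congr_fun hr x
  rw [Module.End.pow_apply] at h
  refine Eq.trans (congrArg (fun F : R → R => F^[p] x) (funext fun y => ?_)) h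
  simp [sub_eq_add_neg]

theorem sum_pow_prime_eq_zero {R ι : Type*} [Ring R] {p : ℕ} (hp : p.Prime) (hR : (p : R) = 0)
    (s : Finset ι) (f : ι → R) (hc : ∀ i j, Commute (f i) (f j)) (hf : ∀ i, f i ^ p = 0) :
    (∑ i ∈ s, f i) ^ p = 0 := by
  classical
  induction s using Finset.induction_on with
  | empty => rw [Finset.sum_empty, zero_pow hp.ne_zero]
  | insert i s hi ih =>
    obtain ⟨r, hr⟩ :=
      (Commute.sum_right s f (f i) fun j _ => hc i j).exists_add_pow_prime_eq hp
    rw [Finset.sum_insert hi, hr, hf, ih, hR]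
    simp

/-- The operator `x_i ^ 2 ∂_i + c x_i` on `Pol_n`. -/
def eulerOp (i : Fin n) (c : k) : Module.End k (Pol k n) :=
  LinearMap.mulLeft k (X i ^ 2) * (pderiv i).toLinearMap + LinearMap.mulLeft k (C c * X i)

theorem eulerOp_monomial (i : Fin n) (c : k) (m : Fin n →₀ ℕ) (b : k) :
    eulerOp k i c (monomial m b) =
      monomial (m + Finsupp.single i 1) ((m i + c) * b) := by
  change X i ^ 2 * pderiv i (monomial m b) + C c * X i * monomial m b = _
  rw [pderiv_monomial, X_pow_eq_monomial, monomial_mul, X, C_mul_monomial, monomial_mul, mul_one,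
    one_mul, add_mul, map_add]
  congr 1
  -- For `m i = 0` the subtraction of exponents is truncated, but the coefficient is zero.
  · rcases Nat.eq_zero_or_pos (m i) with h | h
    · simp [h]
    · have e : Finsupp.single i 2 + (m - Finsupp.single i 1) = m + Finsupp.single i 1 := by
        ext j
        simp only [Finsupp.add_apply, Finsupp.tsub_apply, Finsupp.single_apply]
        split_ifs with hj
        · subst hj
          omega
        · omega
      rw [e, mul_comm b]
  · rw [add_comm]

theorem eulerOp_commute (i j : Fin n) (c d : k) (hij : i = j → c = d) :
    Commute (eulerOp k i c) (eulerOp k j d) := by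
  by_cases h : i = j
  · subst h
    rw [hij rfl]
  · refine MvPolynomial.linearMap_ext fun m => LinearMap.ext fun b => ?_
    change eulerOp k i c (eulerOp k j d (monomial m b)) =
      eulerOp k j d (eulerOp k i c (monomial m b))
    simp only [eulerOp_monomial, Finsupp.add_apply, Finsupp.single_eq_of_ne h,
      Finsupp.single_eq_of_ne (Ne.symm h), add_zero]
    rw [add_right_comm, mul_left_comm]

theorem eulerOp_pow_monomial (i : Fin n) (c : k) (m : Fin n →₀ ℕ) (b : k) (r : ℕ) :
    (eulerOp k i c ^ r) (monomial m b) =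
      monomial (m + Finsupp.single i r) ((∏ t ∈ Finset.range r, (((m i + t : ℕ) : k) + c)) * b) := by
  induction r with
  | zero => simp
  | succ r ih =>
    rw [pow_succ', Module.End.mul_apply, ih, eulerOp_monomial, add_assoc, ← Finsupp.single_add,
      Finset.prod_range_succ]
    congr 1
    rw [Finsupp.add_apply, Finsupp.single_eq_same]
    ring

theorem eulerOp_pow_char {p : ℕ} (hp : p.Prime) [CharP k p] (i : Fin n) (z : ℤ) :
    eulerOp k i (z : k) ^ p = 0 := by
  refine MvPolynomial.linearMap_ext fun m => LinearMap.ext fun b => ?_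
  change (eulerOp k i (z : k) ^ p) (monomial m b) = 0
  rw [eulerOp_pow_monomial]
  have hp0 : (0 : ℤ) < p := by exact_mod_cast hp.pos
  -- The coefficient of the `p`-th power is the product of `m_i + t + z` over `0 ≤ t < p`; this `t`
  -- is the residue at which the factor vanishes modulo `p`.
  set t : ℤ := (-(m i + z)) % p with ht
  have ht0 : 0 ≤ t := Int.emod_nonneg _ hp0.ne'
  have htp : t < p := Int.emod_lt_of_pos _ hp0
  have hz : (((m i + t.toNat : ℕ) : k) + z) = 0 := by
    have hd : (p : ℤ) ∣ m i + t + z := by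
      have := Int.emod_add_mul_ediv (-(m i + z)) p
      exact ⟨-((-(m i + z)) / p), by rw [mul_neg]; linarith⟩
    have h := (CharP.intCast_eq_zero_iff k p _).2 hd
    rw [← h]
    have hn : ((t.toNat : ℕ) : k) = ((t : ℤ) : k) := by
      rw [← Int.cast_natCast, Int.toNat_of_nonneg ht0]
    push_cast
    rw [hn]
  rw [Finset.prod_eq_zero (i := t.toNat) (Finset.mem_range.2 (by omega)) hz, zero_mul,
    monomial_zero]

theorem twistedD_eq_sum_eulerOp (α : Fin n → k) : twistedD k α = ∑ i, eulerOp k i (α i) := by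
  have hsum : ∀ f, (∑ i, (X i ^ 2 : Pol k n) • pderiv i : Derivation k (Pol k n) (Pol k n)) f =
      ∑ i, X i ^ 2 * pderiv i f := fun f => by
    have := congrFun (map_sum Derivation.coeFnAddMonoidHom
      (fun i => (X i ^ 2 : Pol k n) • pderiv (R := k) i) Finset.univ) f
    rw [Finset.sum_apply] at this
    exact this
  have h : polD k n = ∑ i, (X i ^ 2 : Pol k n) • pderiv i := by
    refine derivation_ext fun j => ?_
    rw [hsum, Finset.sum_eq_single j, pderiv_X_self, mul_one]
    · exact mkDerivation_X _ _ _
    · intro i _ hi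
      rw [pderiv_X_of_ne hi.symm, mul_zero]
    · simp
  refine LinearMap.ext fun f => ?_
  rw [LinearMap.sum_apply, twistedD, LinearMap.add_apply, h]
  change (∑ i, (X i ^ 2 : Pol k n) • pderiv i : Derivation k (Pol k n) (Pol k n)) f +
    (∑ i, C (α i) * X i) * f = ∑ i, (X i ^ 2 * pderiv i f + C (α i) * X i * f)
  rw [hsum, Finset.sum_add_distrib, Finset.sum_mul]

theorem twistedD_pow_char {p : ℕ} (hp : p.Prime) [CharP k p] (z : Fin n → ℤ) :
    twistedD k (fun i => (z i : k)) ^ p = 0 := by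
  rw [twistedD_eq_sum_eulerOp]
  refine sum_pow_prime_eq_zero hp ?_ _ _ (fun i j => eulerOp_commute k i j _ _ ?_)
    (fun i => eulerOp_pow_char k hp i (z i))
  · refine LinearMap.ext fun f => ?_
    rw [Module.End.natCast_apply, ← Nat.cast_smul_eq_nsmul k, CharP.cast_eq_zero, zero_smul]
    rfl
  · rintro rfl
    rfl

theorem commD_iterate_char {p : ℕ} (hp : p.Prime) [CharP k p] (z : Fin n → ℤ)
    (ξ : EnhNilHecke k n) : (commD k fun i => (z i : k))^[p] ξ = 0 := by
  refine toEnd_injective k ?_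
  set D := extendEnd k n (twistedD k fun i => (z i : k)) with hD
  have hs : Function.Semiconj (toEnd k n) (commD k fun i => (z i : k))
      (fun y => D * y - y * D) := fun ξ => toEnd_commD k _ ξ
  rw [(hs.iterate_right p).eq, map_zero]
  refine iterate_commutator_eq_zero hp ?_ ?_ _
  · refine LinearMap.ext fun f => ?_
    rw [Module.End.natCast_apply, ← Nat.cast_smul_eq_nsmul k, CharP.cast_eq_zero, zero_smul]
    rfl
  · rw [hD, ← map_pow, twistedD_pow_char k hp, map_zero]

end EnhancedNilHecke

end

/-! ### The main theorem -/

open EnhancedNilHecke in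
theorem proposition2p22 (k : Type*) [CommRing k] (n : ℕ) (a : k) :
    ∃ d : EnhNilHecke k n →ₗ[k] EnhNilHecke k n,
      -- `d` is the unique derivation with the given values on generators
      IsEnhancedDerivation k a d ∧
      (∀ d' : EnhNilHecke k n →ₗ[k] EnhNilHecke k n, IsEnhancedDerivation k a d' → d' = d) ∧
      -- `d` restricts to the Khovanov–Qi derivation on the nilHecke algebra
      (∃ ι : NilHecke k n →ₐ[k] EnhNilHecke k n, Function.Injective ι ∧
        (∀ (ξ : NilHecke k n) (f : Pol k n), ι ξ (ofPol k n f) = ofPol k n (ξ f)) ∧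
        ∀ α : Fin n → k, (∀ j : Fin (n - 1), α (hi j) - α (lo j) = a) →
          ∀ ξ : NilHecke k n, d (ι ξ) = ι (khovanovQi k α ξ)) ∧
      -- `d` kills `ω_n`
      (∀ i : Fin n, (i : ℕ) + 1 = n → d (Omop k i) = 0) ∧
      -- in characteristic `p`, with `a` in the prime field, this is a `p`-dg algebra
      (∀ p : ℕ, p.Prime → CharP k p → (∃ m : ℤ, a = m) → 
        IsPDGAlgebra (k := k) (A := EnhNilHecke k n) p (enhDeg k n) d) := by
  -- The choice `α_i = i a`, with `i` counted from 0, is one sequence with constant difference `a`.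
  -- Any other gives the same derivation on `nh_n`.
  have hβ : ∀ j : Fin (n - 1),
      (fun i : Fin n => ((i : ℕ) : k) * a) (hi j) - (fun i : Fin n => ((i : ℕ) : k) * a) (lo j)
        = a := fun j => by
    simp only [lo, hi]
    push_cast
    ring
  have hd := isEnhancedDerivation_commD k (α := fun i : Fin n => ((i : ℕ) : k) * a) hβ
  refine ⟨commD k fun i => ((i : ℕ) : k) * a, hd, fun d' hd' => hd.unique hd',
    ⟨nilHeckeIncl k n, nilHeckeIncl_injective k, nilHeckeIncl_ofPol k, fun α hα ξ => ?_⟩,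
    fun i hi => ?_, fun p hp hk => ?_⟩
  · rw [commD_nilHeckeIncl, khovanovQi_eq_of_sub_eq k fun j => (hβ j).trans (hα j).symm]
  · rw [hd.map_Om]
    refine Finset.sum_eq_zero fun j hj => ?_
    have : i < j := Finset.mem_Ioi.1 hj
    omega
  · rintro ⟨m, rfl⟩
    refine ⟨inferInstance, enhDeg_isInternal k, commD_mul k _, fun i ξ hξ =>
      commD_mem_enhDeg k _ hξ, fun ξ => ?_⟩
    -- When `a` is the image of an integer `m`, all `α_i = i a` are images of integers too.
    have h := commD_iterate_char k hp (fun i : Fin n => ((i : ℕ) : ℤ) * m) ξ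
    simpa using h
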